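/- Fix an integer $k\ge 2$, let $k^{\mathbb Z}=\{1,\dots,k\}^{\mathbb Z}$ carry the product topology, and let $T$ be the shift on it, $(T\omega)_n=\omega_{n+1}$. Let $\mathrm{GL}_+(2,\mathbb R)$ be the group of real $2\times2$ matrices with positive determinant. The one-step cocycle generated by $\mathsf A=(A_1,\dots,A_k)\in \mathrm{GL}_+(2,\mathbb R)^k$ is given by $A(\omega)=A_{\omega_0}$; its products are $A^{(n)}(\omega)=A_{\omega_{n-1}}\cdots A_{\omega_0}$ for $n\ge 0$ and $A^{(-n)}(\omega)=\big(A^{(n)}(T^{-n}\omega)\big)^{-1}$ for $n\geq 1$. Let $\|L\|$ be the Euclidean operator norm of a matrix $L$ and $\mathfrak m(L)=\|L^{-1}\|^{-1}$. The cocycle is called dominated if for each $\omega\in k^{\mathbb Z}$ there is a splitting $\mathbb R^2=e_1(\omega)\oplus e_2(\omega)$ into one-dimensional subspaces such that $A(\omega)(e_i(\omega))=e_i(T\omega)$ for all $\omega$ and $i\in\{1,2\}$, and there are constants $c,\delta>0$ such that $$\frac{\|A^{(n)}(\omega)|e_1(\omega)\|}{\|A^{(n)}(\omega)|e_2(\omega)\|}\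 \ge\ c\,e^{\delta n}\qquad\text{for all }\omega\in k^{\mathbb Z}\text{ and } n\ge 1 .$$ There exists an open and dense subset $\mathcal V$ of $\mathrm{GL}_+(2,\mathbb R)^k$ such that for every $\mathsf A\in\mathcal V$: 1. either the one-step cocycle generated by $\mathsf A$ is dominated; 2. or there exists a compact set $K\subset k^{\mathbb Z}$ with $T(K)=K$, such that $T|_K$ has positive topological entropy and the non-conformalities $\|A^{(n)}(\omega)\|/\mathfrak m(A^{(n)}(\omega))$ are uniformly bounded over $(\omega,n)\in K\times\mathbb Z$. -/

import Mathlib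

open scoped MatrixGroups

noncomputable section

/-- The `2 × 2` real invertible matrix `L` as an operator of the Euclidean plane. -/
def euclOp (L : GL (Fin 2) ℝ) :
    EuclideanSpace ℝ (Fin 2) →L[ℝ] EuclideanSpace ℝ (Fin 2) :=
  Matrix.toEuclideanCLM (n := Fin 2) (𝕜 := ℝ) (L : Matrix (Fin 2) (Fin 2) ℝ)

/-- The mininorm `𝔪(L) = ‖L⁻¹‖⁻¹` (Euclidean operator norm). -/
def mininorm (L : GL (Fin 2) ℝ) : ℝ := ‖euclOp L⁻¹‖⁻¹

/-- The non-conformality `‖L‖ / 𝔪(L)`. -/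
def nonConformality (L : GL (Fin 2) ℝ) : ℝ := ‖euclOp L‖ / mininorm L

/-- The products `A^{(n)}(ω) = A(T^{n-1} ω) ⋯ A(ω)` for `n ≥ 0`. -/
def cocycleProd {Ω : Type*} (T : Ω → Ω) (A : Ω → GL (Fin 2) ℝ) : ℕ → Ω → GL (Fin 2) ℝ
  | 0, _ => 1
  | n + 1, ω => A (T^[n] ω) * cocycleProd T A n ω

/-- The products `A^{(n)}(ω)` for `n ∈ ℤ`, over an invertible `T`; for negative times
`A^{(-n)}(ω) = (A^{(n)}(T^{-n} ω))⁻¹`. -/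
def cocycleZProd {Ω : Type*} [TopologicalSpace Ω] (T : Ω ≃ₜ Ω) (A : Ω → GL (Fin 2) ℝ) :
    ℤ → Ω → GL (Fin 2) ℝ
  | Int.ofNat n, ω => cocycleProd T A n ω
  | Int.negSucc n, ω => (cocycleProd T A (n + 1) (T.symm^[n + 1] ω))⁻¹

/-- `e₁ ⊕ e₂` is a dominated splitting for the cocycle `(T, A)`. -/
structure IsDominatedSplitting {Ω : Type*} [TopologicalSpace Ω] (T : Ω ≃ₜ Ω)
    (A : Ω → GL (Fin 2) ℝ) (e₁ e₂ : Ω → Submodule ℝ (EuclideanSpace ℝ (Fin 2))) : Prop where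
  finrank_fst : ∀ ω, Module.finrank ℝ (e₁ ω) = 1
  finrank_snd : ∀ ω, Module.finrank ℝ (e₂ ω) = 1
  isCompl : ∀ ω, IsCompl (e₁ ω) (e₂ ω)
  equivariant_fst : ∀ ω, (e₁ ω).map (euclOp (A ω)).toLinearMap = e₁ (T ω)
  equivariant_snd : ∀ ω, (e₂ ω).map (euclOp (A ω)).toLinearMap = e₂ (T ω)
  dominance : ∃ c > (0 : ℝ), ∃ δ > (0 : ℝ), ∀ ω, ∀ n : ℕ, 1 ≤ n →
    c * Real.exp (δ * n) ≤
      ‖(euclOp (cocycleProd T A n ω)).comp (e₁ ω).subtypeL‖ /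
        ‖(euclOp (cocycleProd T A n ω)).comp (e₂ ω).subtypeL‖

/-- The cocycle `(T, A)` is dominated if it admits a dominated splitting. -/
def IsDominated {Ω : Type*} [TopologicalSpace Ω] (T : Ω ≃ₜ Ω) (A : Ω → GL (Fin 2) ℝ) : Prop :=
  ∃ e₁ e₂ : Ω → Submodule ℝ (EuclideanSpace ℝ (Fin 2)), IsDominatedSplitting T A e₁ e₂

/-- The shift `(Tω)_n = ω_{n+1}` on the space of bi-infinite words in `k` symbols. -/
def fullShift (k : ℕ) : (ℤ → Fin k) ≃ₜ (ℤ → Fin k) where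
  toFun ω n := ω (n + 1)
  invFun ω n := ω (n - 1)
  left_inv ω := by funext n; simp
  right_inv ω := by funext n; simp
  continuous_toFun := by fun_prop
  continuous_invFun := by fun_prop

/-- The topological entropy of the shift on a set `K` of words: the Bowen entropy with respect to
the product of the discrete uniformities, the only uniformity that induces the product topology of
the discrete topologies. -/
def shiftEntropy (k : ℕ) (K : Set (ℤ → Fin k)) : EReal :=
  letI : UniformSpace (Fin k) := ⊥
  Dynamics.coverEntropy (fullShift k) K

/-- The one-step map `A(ω) = A_{ω₀}` with generator `(A₁, …, A_k)` in `GL₊(2, ℝ)`. -/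
def oneStep {k : ℕ} (A : Fin k → GL(2, ℝ)⁺) (ω : ℤ → Fin k) : GL (Fin 2) ℝ :=
  (A (ω 0) : GL (Fin 2) ℝ)

end

/-! The set `V` is the union of the interior of the dominated tuples and the open set of tuples with
`DiskCovering`. The second set yields the alternative with bounded non-conformality. Density rests
on the following dichotomy.

Suppose that for some `ε > 0` no product of the tuples `rotMat θ * A i`, `|θ| ≤ ε`, is elliptic.
Then `A` is dominated (`isDominated_of_no_elliptic`). Lift the action on directions to increasing
homeomorphisms of the line commuting with the translation by `π`. A non-elliptic product moves some
point by a multiple of `π`; as this holds throughout the interval of angles, the multiple cannot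
increase with `θ`. Hence suitable orbits of the systems rotated by `-ε` and by `ε` stay within `π`
of each other (`exists_window`), and a compactness argument makes them two-sided
(`exists_cone_sequence`). They bound cones that `A` maps into the next cones with a margin `ε` on
both sides. The quadratic form vanishing on the two sides of the cone then separates an expanded
direction inside the cones from a contracted one outside, at a uniform exponential rate.

So arbitrarily close to a non-dominated tuple there is one with an elliptic product `W`. A further
small change makes the rotation conjugate to `W` (up to scale) of infinite order and some generator
`B v` not commute with `W` (`exists_generic_near`). In the disk model of the hyperbolic plane,
powers of `W` rotate every point of a suitable closed disk to a place from which `B v` sends it into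
the open disk of the same radius, and this can be done by two different words of one fixed length
`l` (`diskCovering_of_elliptic`). Strict inequalities on a compact disk persist under perturbation.

Choosing one of the two words at each stage keeps all products at bounded distance from conformal
matrices and gives a binary tree of words (`exists_bounded_branching`). The two-sided words all of
whose products have eccentricity at most `C` form the compact invariant set; it contains `2 ^ n`
words told apart by `l * n` letters for each `n`, so its entropy is positive. -/

/-- The unit vector with argument `x`. -/
noncomputable def unitVec (x : ℝ) : Fin 2 → ℝ := ![Real.cos x, Real.sin x]

/-! ### Lifts to the line of the action on directions -/

/-- `F` is a lift to the line of arguments of the action of `M` on directions. -/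
structure IsAngleLift (M : Matrix (Fin 2) (Fin 2) ℝ) (F : ℝ ≃ₜ ℝ) : Prop where
  strictMono : StrictMono F
  map_add_pi : ∀ x, F (x + Real.pi) = F x + Real.pi
  map_unitVec : ∀ x, ∃ r : ℝ, 0 < r ∧ M.mulVec (unitVec x) = r • unitVec (F x)

lemma IsAngleLift.comp {M N : Matrix (Fin 2) (Fin 2) ℝ} {F G : ℝ ≃ₜ ℝ}
    (hN : IsAngleLift N G) (hM : IsAngleLift M F) : IsAngleLift (N * M) (G * F) where
  strictMono := hN.strictMono.comp hM.strictMono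
  map_add_pi x := by
    change G (F (x + _)) = G (F x) + _
    rw [hM.map_add_pi, hN.map_add_pi]
  map_unitVec x := by
    obtain ⟨r, hr, h⟩ := hM.map_unitVec x
    obtain ⟨s, hs, h'⟩ := hN.map_unitVec (F x)
    refine ⟨r * s, by positivity, ?_⟩
    change _ = _ • unitVec (G (F x))
    rw [← Matrix.mulVec_mulVec, h, Matrix.mulVec_smul, h', smul_smul]

lemma IsAngleLift.one : IsAngleLift 1 1 where
  strictMono := strictMono_id
  map_add_pi _ := rfl
  map_unitVec x := ⟨1, one_pos, by
    rw [Matrix.one_mulVec, one_smul]; rfl⟩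

/-- The rotation matrix of angle `θ`. -/
noncomputable def rotMat (θ : ℝ) : Matrix (Fin 2) (Fin 2) ℝ :=
  !![Real.cos θ, -Real.sin θ; Real.sin θ, Real.cos θ]

lemma det_rotMat (θ : ℝ) : (rotMat θ).det = 1 := by
  simp only [rotMat, Matrix.det_fin_two_of]
  linarith [Real.sin_sq_add_cos_sq θ]

lemma IsAngleLift.rotMat (θ : ℝ) : IsAngleLift (rotMat θ) (Homeomorph.addRight θ) where
  strictMono _ _ h := by simpa using h
  map_add_pi x := by simp [add_right_comm]
  map_unitVec x := ⟨1, one_pos, by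
    ext i
    fin_cases i <;>
    simp [_root_.rotMat, unitVec, Matrix.mulVec, dotProduct, Fin.sum_univ_two, Real.cos_add,
      Real.sin_add] <;> ring⟩

/-- The complex linear part of a real `2 × 2` matrix. -/
noncomputable def linPart (M : Matrix (Fin 2) (Fin 2) ℝ) : ℂ :=
  ⟨(M 0 0 + M 1 1) / 2, (M 1 0 - M 0 1) / 2⟩

/-- The complex antilinear part of a real `2 × 2` matrix. -/
noncomputable def antiPart (M : Matrix (Fin 2) (Fin 2) ℝ) : ℂ :=
  ⟨(M 0 0 - M 1 1) / 2, (M 1 0 + M 0 1) / 2⟩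

lemma det_eq_normSq_sub (M : Matrix (Fin 2) (Fin 2) ℝ) :
    M.det = Complex.normSq (linPart M) - Complex.normSq (antiPart M) := by
  simp only [Matrix.det_fin_two, linPart, antiPart, Complex.normSq_mk]
  ring

lemma linPart_mul (M N : Matrix (Fin 2) (Fin 2) ℝ) :
    linPart (M * N) = linPart M * linPart N + antiPart M * star (antiPart N) := by
  apply Complex.ext <;> simp [linPart, antiPart, Matrix.mul_apply, Fin.sum_univ_two] <;> ring

lemma antiPart_mul (M N : Matrix (Fin 2) (Fin 2) ℝ) :
    antiPart (M * N) = linPart M * antiPart N + antiPart M * star (linPart N) := by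
  apply Complex.ext <;> simp [linPart, antiPart, Matrix.mul_apply, Fin.sum_univ_two] <;> ring

lemma unitVec_eq_of_smul_eq {r s x y : ℝ} (hr : 0 < r) (hs : 0 < s)
    (h : r • unitVec x = s • unitVec y) : unitVec x = unitVec y := by
  have h0 : r * Real.cos x = s * Real.cos y := by simpa [unitVec] using congrFun h 0
  have h1 : r * Real.sin x = s * Real.sin y := by simpa [unitVec] using congrFun h 1
  have : r ^ 2 = s ^ 2 := by
    have e := Real.sin_sq_add_cos_sq x
    have e' := Real.sin_sq_add_cos_sq y
    calc r ^ 2 = (r * Real.cos x) ^ 2 + (r * Real.sin x) ^ 2 := by linear_combination -r ^ 2 * e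
      _ = s ^ 2 := by rw [h0, h1]; linear_combination s ^ 2 * e'
  have hrs : r = s := by
    rwa [sq_eq_sq₀ hr.le hs.le] at this
  subst hrs
  exact smul_right_injective _ hr.ne' h

lemma exists_int_of_unitVec_eq {x y : ℝ} (h : unitVec x = unitVec y) :
    ∃ n : ℤ, x = y + n * (2 * Real.pi) := by
  have h0 : Real.cos x = Real.cos y := by simpa [unitVec] using congrFun h 0
  have h1 : Real.sin x = Real.sin y := by simpa [unitVec] using congrFun h 1
  have : (x : Real.Angle) = y := Real.Angle.cos_sin_inj h0 h1
  obtain ⟨n, hn⟩ := Real.Angle.angle_eq_iff_two_pi_dvd_sub.1 this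
  exact ⟨n, by linarith⟩

lemma map_add_int_mul {F : ℝ → ℝ} {c : ℝ} (h : ∀ x, F (x + c) = F x + c) (n : ℤ) (x : ℝ) :
    F (x + n * c) = F x + n * c := by
  induction n using Int.induction_on with
  | zero => simp
  | succ n ih =>
    push_cast at ih ⊢
    rw [show x + (n + 1) * c = (x + n * c) + c by ring, h, ih]; ring
  | pred n ih =>
    have := h (x + ((-n - 1 : ℤ) : ℝ) * c)
    push_cast at this ih ⊢
    rw [show x + (-(n : ℝ) - 1) * c + c = x + -n * c by ring, ih] at this
    linarith

/-- On `ℂ` the matrix is `z ↦ αz + βz̄`, so `e^{ix}` goes to `α e^{ix} (1 + (β/α) e^{-2ix})`. A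
positive determinant means `|β| < |α|`: the last factor stays in the unit disk around `1`, where the
argument is continuous. This gives an explicit formula for the lift. -/
lemma exists_isAngleLift {M : Matrix (Fin 2) (Fin 2) ℝ} (hM : 0 < M.det) :
    ∃ F : ℝ ≃ₜ ℝ, IsAngleLift M F := by
  set α := linPart M with hα
  set β := antiPart M with hβ
  have hdet : Complex.normSq β < Complex.normSq α := by
    have := det_eq_normSq_sub M
    linarith
  have hα0 : α ≠ 0 := by
    rintro h
    rw [h] at hdet
    have := Complex.normSq_nonneg β
    simp at hdet
    linarith
  set e : ℝ → ℂ := fun x => 1 + β / α * Complex.exp (-(2 * x) * Complex.I) with he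
  have hlt : ∀ x : ℝ, ‖β / α * Complex.exp (-(2 * x) * Complex.I)‖ < 1 := by
    intro x
    have : ‖Complex.exp (-(2 * x) * Complex.I)‖ = 1 := by
      have := Complex.norm_exp_ofReal_mul_I (-(2 * x))
      simpa using this
    rw [norm_mul, this, mul_one, norm_div, div_lt_one (norm_pos_iff.2 hα0)]
    rw [Complex.normSq_eq_norm_sq, Complex.normSq_eq_norm_sq] at hdet
    exact lt_of_pow_lt_pow_left₀ 2 (norm_nonneg _) hdet
  have hslit : ∀ x, e x ∈ Complex.slitPlane := by
    intro x
    exact Complex.mem_slitPlane_of_norm_lt_one (hlt x)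
  have hecont : Continuous e := by fun_prop
  set F : ℝ → ℝ := fun x => x + Complex.arg α + Complex.arg (e x) with hF
  have hcont : Continuous F := by
    have : Continuous fun x => Complex.arg (e x) :=
      continuous_iff_continuousAt.2 fun x =>
        (Complex.continuousAt_arg (hslit x)).comp hecont.continuousAt
    fun_prop
  have hpi : ∀ x, F (x + Real.pi) = F x + Real.pi := by
    intro x
    have : e (x + Real.pi) = e x := by
      simp only [he]
      congr 2
      rw [Complex.exp_eq_exp_iff_exists_int]
      exact ⟨-1, by push_cast; ring⟩
    simp only [hF, this]
    ring
  have hunit : ∀ x, ∃ r : ℝ, 0 < r ∧ M.mulVec (unitVec x) = r • unitVec (F x) := by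
    intro x
    refine ⟨‖α‖ * ‖e x‖, mul_pos (norm_pos_iff.2 hα0)
      (norm_pos_iff.2 (Complex.slitPlane_ne_zero (hslit x))), ?_⟩
    have key : α * Complex.exp (x * Complex.I) + β * Complex.exp (-x * Complex.I)
        = (‖α‖ * ‖e x‖ : ℝ) * Complex.exp (F x * Complex.I) := by
      have h1 := Complex.norm_mul_exp_arg_mul_I α
      have h2 := Complex.norm_mul_exp_arg_mul_I (e x)
      calc _ = α * e x * Complex.exp (x * Complex.I) := by
            simp only [he]
            rw [mul_add, add_mul, mul_one, add_right_inj, ← mul_assoc, mul_div_cancel₀ _ hα0,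
              mul_assoc, ← Complex.exp_add]
            congr 2; ring
        _ = _ := by
            nth_rw 1 [← h1, ← h2]
            simp only [hF]
            push_cast
            rw [add_mul, add_mul, Complex.exp_add, Complex.exp_add]
            ring
    clear_value e F
    have hre := congrArg Complex.re key
    have him := congrArg Complex.im key
    rw [show (-(x : ℂ)) = ((-x : ℝ) : ℂ) by push_cast; ring] at hre him
    simp only [Complex.add_re, Complex.mul_re, Complex.exp_ofReal_mul_I_re,
      Complex.exp_ofReal_mul_I_im, Complex.add_im, Complex.mul_im, Complex.ofReal_re,
      Complex.ofReal_im, Real.cos_neg, Real.sin_neg] at hre him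
    generalize ‖α‖ * ‖e x‖ = r at hre him ⊢
    simp only [hα, hβ, linPart, antiPart] at hre him
    ext i
    fin_cases i
    · simp [unitVec, Matrix.mulVec, dotProduct, Fin.sum_univ_two]
      linarith
    · simp [unitVec, Matrix.mulVec, dotProduct, Fin.sum_univ_two]
      linarith
  -- Equal images force `x - y` to be a multiple of `2π`, and commutation with the translation by
  -- `π` then leaves only the multiple zero.
  have hinj : Function.Injective F := by
    intro x y hxy
    obtain ⟨r, hr, h⟩ := hunit x
    obtain ⟨s, hs, h'⟩ := hunit y
    have h3 : M.mulVec (s • unitVec x) = M.mulVec (r • unitVec y) := by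
      rw [Matrix.mulVec_smul, Matrix.mulVec_smul, h, h', hxy, smul_comm]
    have h4 := Matrix.mulVec_injective_iff_isUnit.2
      ((Matrix.isUnit_iff_isUnit_det M).2 hM.ne'.isUnit) h3
    obtain ⟨n, hn⟩ := exists_int_of_unitVec_eq (unitVec_eq_of_smul_eq hs hr h4)
    have h5 := map_add_int_mul hpi (2 * n) y
    push_cast at h5
    rw [show y + 2 * n * Real.pi = x by rw [hn]; ring, hxy] at h5
    rw [hn]; linarith
  have hmono : StrictMono F := by
    refine (hcont.strictMono_of_inj hinj).resolve_right fun h => ?_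
    have h1 := h Real.pi_pos
    have h2 := hpi 0
    rw [zero_add] at h2
    linarith [Real.pi_pos]
  have hsurj : Function.Surjective F := by
    apply hcont.surjective
    · refine Filter.tendsto_atTop_mono (f := fun x : ℝ => x + (Complex.arg α - Real.pi)) (fun x => ?_)
        (Filter.tendsto_atTop_add_const_right _ _ Filter.tendsto_id)
      have := Complex.neg_pi_lt_arg (e x)
      simp only [hF]; linarith
    · refine Filter.tendsto_atBot_mono (f := fun x : ℝ => x + (Complex.arg α + Real.pi)) (fun x => ?_)
        (Filter.tendsto_atBot_add_const_right _ _ Filter.tendsto_id)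
      have := Complex.arg_le_pi (e x)
      simp only [hF]; linarith
  exact ⟨(hmono.orderIsoOfSurjective F hsurj).toHomeomorph, hmono, hpi, hunit⟩

/-! ### Fixed directions of rotated products -/

/-- The product `A (x (n - 1)) * ⋯ * A (x 0)`. -/
def seqProd {G ι : Type*} [Monoid G] (A : ι → G) (x : ℕ → ι) : ℕ → G
  | 0 => 1
  | n + 1 => A (x n) * seqProd A x n

/-- The discriminant of the characteristic polynomial is nonnegative, so there is a real
eigenvector. Its eigenvalue may be negative, which is why the displacement is a multiple of `π` and
not of `2π`. -/
lemma exists_fixed_direction {M : Matrix (Fin 2) (Fin 2) ℝ} {F : ℝ ≃ₜ ℝ} (hF : IsAngleLift M F)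
    (hdet : 0 < M.det) (htr : 4 * M.det ≤ M.trace ^ 2) :
    ∃ (z : ℝ) (m : ℤ), F z = z + m * Real.pi := by
  set l : ℝ := (M.trace + √(M.trace ^ 2 - 4 * M.det)) / 2 with hl
  have hroot : l ^ 2 - M.trace * l + M.det = 0 := by
    have := Real.sq_sqrt (sub_nonneg.2 htr)
    rw [hl]; linear_combination this / 4
  have hl0 : l ≠ 0 := by
    rintro h
    rw [h] at hroot
    linarith
  have hsing : (M - Matrix.scalar (Fin 2) l).det = 0 := by
    rw [← hroot, Matrix.trace_fin_two, Matrix.det_fin_two, Matrix.det_fin_two]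
    simp
    ring
  obtain ⟨v, hv0, hv⟩ := Matrix.exists_mulVec_eq_zero_iff.2 hsing
  have hv' : M.mulVec v = l • v := by
    rw [Matrix.sub_mulVec, sub_eq_zero] at hv
    rw [hv]
    ext i
    simp [Matrix.scalar_apply, Matrix.mulVec_diagonal]
  set w : ℂ := ⟨v 0, v 1⟩ with hw
  have hw0 : w ≠ 0 := by
    rintro h
    apply hv0
    have h0 := congrArg Complex.re h
    have h1 := congrArg Complex.im h
    ext i
    fin_cases i
    · exact h0
    · exact h1
  have hvw : v = ‖w‖ • unitVec w.arg := by
    ext i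
    fin_cases i
    · simp [unitVec, hw, Complex.norm_mul_cos_arg]
    · simp [unitVec, hw, Complex.norm_mul_sin_arg]
  have hu : M.mulVec (unitVec w.arg) = l • unitVec w.arg := by
    rw [hvw, Matrix.mulVec_smul, smul_comm] at hv'
    exact smul_right_injective _ (norm_ne_zero_iff.2 hw0) hv'
  obtain ⟨r, hr, h⟩ := hF.map_unitVec w.arg
  rw [hu] at h
  have h0 : l * Real.cos w.arg = r * Real.cos (F w.arg) := by simpa [unitVec] using congrFun h 0
  have h1 : l * Real.sin w.arg = r * Real.sin (F w.arg) := by simpa [unitVec] using congrFun h 1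
  have hs : Real.sin (F w.arg - w.arg) = 0 := by
    rw [Real.sin_sub]
    have : r * (Real.sin (F w.arg) * Real.cos w.arg - Real.cos (F w.arg) * Real.sin w.arg) = 0 := by
      linear_combination (-Real.cos w.arg) * h1 + Real.sin w.arg * h0
    exact (mul_eq_zero.1 this).resolve_left hr.ne'
  obtain ⟨m, hm⟩ := Real.sin_eq_zero_iff.1 hs
  exact ⟨w.arg, m, by linarith⟩

section Window

variable {ι : Type*} {A : ι → Matrix (Fin 2) (Fin 2) ℝ} {F : ι → ℝ ≃ₜ ℝ}

lemma isAngleLift_seqProd (hF : ∀ i, IsAngleLift (A i) (F i)) (x : ℕ → ι) (n : ℕ) :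
    IsAngleLift (seqProd A x n) (seqProd F x n) := by
  induction n with
  | zero => exact IsAngleLift.one
  | succ n ih => exact (hF _).comp ih

lemma det_seqProd_pos (hA : ∀ i, 0 < (A i).det) (x : ℕ → ι) (n : ℕ) :
    0 < (seqProd A x n).det := by
  induction n with
  | zero => simp [seqProd]
  | succ n ih =>
    rw [seqProd, Matrix.det_mul]
    exact mul_pos (hA _) ih

/-- The lifts `F i` followed by the translation by `θ`. -/
def translated (F : ι → ℝ ≃ₜ ℝ) (θ : ℝ) (i : ι) : ℝ ≃ₜ ℝ := Homeomorph.addRight θ * F i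

@[simp] lemma translated_apply (F : ι → ℝ ≃ₜ ℝ) (θ : ℝ) (i : ι) (z : ℝ) :
    translated F θ i z = F i z + θ := rfl

lemma isAngleLift_translated (hF : ∀ i, IsAngleLift (A i) (F i)) (θ : ℝ) (i : ι) :
    IsAngleLift (rotMat θ * A i) (translated F θ i) :=
  (IsAngleLift.rotMat θ).comp (hF i)

lemma seqProd_succ_apply (F : ι → ℝ ≃ₜ ℝ) (x : ℕ → ι) (n : ℕ) (z : ℝ) :
    seqProd F x (n + 1) z = F (x n) (seqProd F x n z) := rfl

lemma seqProd_translated_mono (hF : ∀ i, StrictMono (F i)) (x : ℕ → ι) (n : ℕ) {θ θ' z z' : ℝ}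
    (hθ : θ ≤ θ') (hz : z ≤ z') :
    seqProd (translated F θ) x n z ≤ seqProd (translated F θ') x n z' := by
  induction n with
  | zero => exact hz
  | succ n ih =>
    simp only [seqProd_succ_apply, translated_apply]
    exact add_le_add ((hF _).monotone ih) hθ

lemma continuous_seqProd_translated (x : ℕ → ι) (n : ℕ) :
    Continuous fun p : ℝ × ℝ => seqProd (translated F p.1) x n p.2 := by
  induction n with
  | zero => exact continuous_snd
  | succ n ih =>
    simp only [seqProd_succ_apply, translated_apply]
    exact ((F _).continuous.comp ih).add continuous_fst

/-- The projection along a compact factor is a closed map. -/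
lemma isClosed_exists_mem_Icc {f g : ℝ × ℝ → ℝ} (hf : Continuous f) (hg : Continuous g) (a b : ℝ) :
    IsClosed {θ : ℝ | ∃ z ∈ Set.Icc a b, f (θ, z) ≤ g (θ, z)} := by
  have : {θ : ℝ | ∃ z ∈ Set.Icc a b, f (θ, z) ≤ g (θ, z)} =
      Prod.fst '' {p : ℝ × Set.Icc a b | f (p.1, p.2) ≤ g (p.1, p.2)} := by
    ext θ
    constructor
    · rintro ⟨z, hz, h⟩
      exact ⟨(θ, ⟨z, hz⟩), h, rfl⟩
    · rintro ⟨⟨θ', z⟩, h, rfl⟩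
      exact ⟨z, z.2, h⟩
  rw [this]
  exact isClosedMap_fst_of_compactSpace _ (isClosed_le (by fun_prop) (by fun_prop))

lemma exists_shift_mem_Ico (c z : ℝ) : ∃ n : ℤ, z + n * Real.pi ∈ Set.Ico c (c + Real.pi) := by
  refine ⟨-⌊(z - c) / Real.pi⌋, ?_⟩
  have h1 := Int.floor_le ((z - c) / Real.pi)
  have h2 := Int.lt_floor_add_one ((z - c) / Real.pi)
  rw [le_div_iff₀ Real.pi_pos] at h1
  rw [div_lt_iff₀ Real.pi_pos] at h2
  push_cast
  constructor <;> linarith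

/-- Here `a` and `b` are points that the products at the angles `-ε` and `ε` move by multiples of
`π`. The lower bound is monotonicity in the angle. For the upper bound, an overtaking by `π` would
persist up to time `n` and force the displacement at `ε` to exceed that at `-ε`. -/
lemma exists_window (hF : ∀ i, IsAngleLift (A i) (F i)) (hA : ∀ i, 0 < (A i).det) {ε : ℝ}
    (hε : 0 ≤ ε) (x : ℕ → ι) (n : ℕ)
    (h : ∀ θ ∈ Set.Icc (-ε) ε, 4 * (seqProd (fun i => rotMat θ * A i) x n).det ≤
      (seqProd (fun i => rotMat θ * A i) x n).trace ^ 2) :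
    ∃ a b : ℝ, ∀ k ≤ n, seqProd (translated F (-ε)) x k a ≤ seqProd (translated F ε) x k b ∧
      seqProd (translated F ε) x k b ≤ seqProd (translated F (-ε)) x k a + Real.pi := by
  set G : ℝ → ℕ → ℝ ≃ₜ ℝ := fun θ k => seqProd (translated F θ) x k with hG
  have hlift : ∀ θ k, IsAngleLift (seqProd (fun i => rotMat θ * A i) x k) (G θ k) := fun θ k =>
    isAngleLift_seqProd (isAngleLift_translated hF θ) x k
  have hint : ∀ θ k (m : ℤ) z, G θ k (z + m * Real.pi) = G θ k z + m * Real.pi := fun θ k m z =>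
    map_add_int_mul (hlift θ k).map_add_pi m z
  have hfix : ∀ θ ∈ Set.Icc (-ε) ε, ∃ z ∈ Set.Icc 0 Real.pi, ∃ m : ℤ,
      G θ n z = z + m * Real.pi := by
    intro θ hθ
    obtain ⟨z, m, hz⟩ := exists_fixed_direction (hlift θ n)
      (det_seqProd_pos (fun i => by rw [Matrix.det_mul, det_rotMat, one_mul]; exact hA i) x n)
      (h θ hθ)
    obtain ⟨j, hj⟩ := exists_shift_mem_Ico 0 z
    rw [zero_add] at hj
    refine ⟨_, Set.Ico_subset_Icc_self hj, m, ?_⟩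
    rw [hint, hz]; ring
  have hmem : ε ∈ Set.Icc (-ε) ε := ⟨by linarith, le_rfl⟩
  have hmem' : -ε ∈ Set.Icc (-ε) ε := ⟨le_rfl, by linarith⟩
  obtain ⟨b, hb, m, hbm⟩ := hfix ε hmem
  obtain ⟨a, ha, m', ham⟩ := hfix (-ε) hmem'
  have hcont := continuous_seqProd_translated (F := F) x n
  -- Otherwise the closed sets of angles admitting a displacement at most `m'π`, respectively at
  -- least `(m'+1)π`, cover the interval and are both nonempty, so they meet. An increasing lift
  -- commuting with the translation by `π` cannot have both kinds of displacement.
  have hmm : m ≤ m' := by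
    by_contra! hlt
    have hpre := isPreconnected_closed_iff.1 (isPreconnected_Icc (a := -ε) (b := ε))
      {θ | ∃ z ∈ Set.Icc 0 Real.pi, G θ n z ≤ z + m' * Real.pi}
      {θ | ∃ z ∈ Set.Icc 0 Real.pi, z + (m' + 1) * Real.pi ≤ G θ n z}
      (isClosed_exists_mem_Icc (f := fun p => G p.1 n p.2) (g := fun p => p.2 + m' * Real.pi)
        hcont (by fun_prop) _ _)
      (isClosed_exists_mem_Icc (f := fun p => p.2 + (m' + 1) * Real.pi)
        (g := fun p => G p.1 n p.2) (by fun_prop) hcont _ _) ?_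
      ⟨-ε, hmem', a, ha, ham.le⟩ ⟨ε, hmem, b, hb, ?_⟩
    · obtain ⟨θ, -, ⟨y, hy, hy'⟩, ⟨z, hz, hz'⟩⟩ := hpre
      obtain ⟨j, hj⟩ := exists_shift_mem_Ico z y
      have h1 : G θ n (y + j * Real.pi) ≤ y + j * Real.pi + m' * Real.pi := by
        rw [hint]; linarith
      have h2 := (hlift θ n).strictMono.monotone hj.1
      have h3 := hj.2
      linarith
    · intro θ hθ
      obtain ⟨z, hz, l, hl⟩ := hfix θ hθ
      rcases le_or_gt l m' with hlm | hlm
      · left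
        refine ⟨z, hz, hl.le.trans ?_⟩
        have : (l : ℝ) ≤ m' := by exact_mod_cast hlm
        nlinarith [Real.pi_pos]
      · right
        refine ⟨z, hz, le_trans ?_ hl.ge⟩
        have : (m' + 1 : ℝ) ≤ l := by exact_mod_cast hlm
        nlinarith [Real.pi_pos]
    · rw [hbm]
      have : (m' + 1 : ℝ) ≤ m := by exact_mod_cast hlt
      nlinarith [Real.pi_pos]
  obtain ⟨j, hj⟩ := exists_shift_mem_Ico a b
  have hmono : ∀ i, StrictMono (F i) := fun i => (hF i).strictMono
  refine ⟨a, b + j * Real.pi, fun k hk => ⟨?_, ?_⟩⟩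
  · exact seqProd_translated_mono hmono x k (by linarith) hj.1
  -- Once the fast orbit is strictly ahead of the slow orbit of `a + π`, monotonicity keeps it
  -- ahead.
  · by_contra! hlt
    have hprop : ∀ l, k ≤ l → G (-ε) l (a + Real.pi) < G ε l (b + j * Real.pi) := by
      intro l hl
      induction l, hl using Nat.le_induction with
      | base => rw [(hlift _ _).map_add_pi]; exact hlt
      | succ l _ ih =>
        simp only [hG, seqProd_succ_apply, translated_apply]
        have := hmono (x l) ih
        simp only [hG] at this
        linarith
    have h1 := hprop n hk
    rw [(hlift _ _).map_add_pi, hint, hbm, ham] at h1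
    have : (m : ℝ) ≤ m' := by exact_mod_cast hmm
    have h3 := hj.2
    nlinarith [Real.pi_pos]

end Window

/-! ### Trigonometry of cones and two-sided products -/

lemma sin_mul_sin_sub (X Y ε : ℝ) :
    Real.sin X * Real.sin Y - Real.sin (X - ε) * Real.sin (Y - ε) =
      Real.sin (X + Y - ε) * Real.sin ε := by
  rw [Real.sin_sub, Real.sin_sub, Real.sin_sub, Real.sin_add, Real.cos_add]
  linear_combination -(Real.sin X * Real.sin Y) * Real.sin_sq_add_cos_sq ε

lemma sin_le_sin_of_mem {ε z : ℝ} (hε : 0 ≤ ε) (h : ε ≤ z) (h' : z ≤ Real.pi - ε) :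
    Real.sin ε ≤ Real.sin z := by
  rcases le_total z (Real.pi / 2) with hz | hz
  · exact Real.sin_le_sin_of_le_of_le_pi_div_two (by linarith) hz h
  · rw [← Real.sin_pi_sub z]
    exact Real.sin_le_sin_of_le_of_le_pi_div_two (by linarith) (by linarith) (by linarith)

/-- The sine of the angle between unit vectors is the area they span, and `M` multiplies areas by
its determinant. -/
lemma det_mul_sin {M : Matrix (Fin 2) (Fin 2) ℝ} {x x' y y' r s : ℝ}
    (hx : M.mulVec (unitVec x) = r • unitVec x') (hy : M.mulVec (unitVec y) = s • unitVec y') :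
    M.det * Real.sin (y - x) = r * s * Real.sin (y' - x') := by
  have h0 := congrFun hx 0
  have h1 := congrFun hx 1
  have h2 := congrFun hy 0
  have h3 := congrFun hy 1
  simp only [unitVec, Matrix.mulVec, dotProduct, Fin.sum_univ_two, Matrix.cons_val_zero,
    Matrix.cons_val_one, Pi.smul_apply, smul_eq_mul] at h0 h1 h2 h3
  rw [Matrix.det_fin_two, Real.sin_sub, Real.sin_sub]
  calc _ = (M 0 0 * Real.cos x + M 0 1 * Real.sin x) * (M 1 0 * Real.cos y + M 1 1 * Real.sin y) -
        (M 1 0 * Real.cos x + M 1 1 * Real.sin x) * (M 0 0 * Real.cos y + M 0 1 * Real.sin y) := by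
        ring
    _ = _ := by rw [h0, h1, h2, h3]; ring

section IntProd

variable {G : Type*} [Group G]

/-- The products `f (-n - 1)⁻¹ * ⋯ * f (-1)⁻¹`. -/
def negProd (f : ℤ → G) : ℕ → G
  | 0 => (f (-1))⁻¹
  | n + 1 => (f (Int.negSucc (n + 1)))⁻¹ * negProd f n

/-- The two-sided products with `intProd f 0 = 1` and `intProd f (k + 1) = f k * intProd f k`. -/
def intProd (f : ℤ → G) : ℤ → G
  | Int.ofNat n => seqProd f (fun j => j) n
  | Int.negSucc n => negProd f n

lemma intProd_zero (f : ℤ → G) : intProd f 0 = 1 := rfl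

lemma intProd_add_one (f : ℤ → G) (k : ℤ) : intProd f (k + 1) = f k * intProd f k := by
  rcases k with n | n
  · rfl
  · rcases n with _ | n
    · exact (mul_inv_cancel (f (-1))).symm
    · change intProd f (Int.negSucc n) = f (Int.negSucc (n + 1)) * ((f (Int.negSucc (n + 1)))⁻¹ * negProd f n)
      rw [mul_inv_cancel_left]
      rfl

lemma intProd_induction {f : ℤ → G} (S : Subgroup G) (h : ∀ k, f k ∈ S) (k : ℤ) :
    intProd f k ∈ S := by
  induction k using Int.induction_on with
  | zero => exact S.one_mem
  | succ n ih =>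
    rw [intProd_add_one]
    exact S.mul_mem (h _) ih
  | pred n ih =>
    have := intProd_add_one f (-n - 1)
    rw [sub_add_cancel] at this
    rw [this] at ih
    exact (S.mul_mem_cancel_left (h _)).1 ih

lemma intProd_add_natCast {ι : Type*} (f : ι → G) (ω : ℤ → ι) (m : ℤ) (n : ℕ) :
    intProd (fun k => f (ω k)) (m + n) =
      seqProd f (fun j => ω (m + j)) n * intProd (fun k => f (ω k)) m := by
  induction n with
  | zero => simp [seqProd]
  | succ n ih =>
    rw [Nat.cast_succ, ← add_assoc, intProd_add_one, ih, seqProd, mul_assoc]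

end IntProd

/-- The increasing homeomorphisms of the line that commute with the translation by `π`. -/
def degreeOneHomeo : Subgroup (ℝ ≃ₜ ℝ) where
  carrier := {F | StrictMono F ∧ ∀ x, F (x + Real.pi) = F x + Real.pi}
  mul_mem' := by
    rintro F G ⟨hF, hF'⟩ ⟨hG, hG'⟩
    refine ⟨hF.comp hG, fun x => ?_⟩
    change F (G (x + _)) = F (G x) + _
    rw [hG', hF']
  one_mem' := ⟨strictMono_id, fun _ => rfl⟩
  inv_mem' := by
    rintro F ⟨hF, hF'⟩
    refine ⟨fun x y hxy => ?_, fun x => ?_⟩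
    · rw [← hF.lt_iff_lt]
      change F (F.symm x) < F (F.symm y)
      simpa using hxy
    · apply F.injective
      rw [hF']
      change F (F.symm _) = F (F.symm _) + _
      simp

/-! ### Cone fields from compactness, and the growth of their quadratic forms -/

section Cones

variable {ι : Type*} {A : ι → Matrix (Fin 2) (Fin 2) ℝ} {F : ι → ℝ ≃ₜ ℝ}

lemma translated_mem_degreeOneHomeo (hF : ∀ i, IsAngleLift (A i) (F i)) (θ : ℝ) (i : ι) :
    translated F θ i ∈ degreeOneHomeo :=
  ⟨(isAngleLift_translated hF θ i).strictMono, (isAngleLift_translated hF θ i).map_add_pi⟩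

lemma homeo_inv_apply (G : ℝ ≃ₜ ℝ) (z : ℝ) : G (G⁻¹ z) = z := G.apply_symm_apply z

/-- Finite windows become two-sided sequences by compactness: a pair of orbits is encoded by its
values at time `0`, and the pairs that behave well at times `|k| ≤ N` form a decreasing sequence of
nonempty compact sets. -/
lemma exists_cone_sequence (hF : ∀ i, IsAngleLift (A i) (F i)) (hA : ∀ i, 0 < (A i).det) {ε : ℝ}
    (hε : 0 ≤ ε)
    (h : ∀ x n, ∀ θ ∈ Set.Icc (-ε) ε, 4 * (seqProd (fun i => rotMat θ * A i) x n).det ≤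
      (seqProd (fun i => rotMat θ * A i) x n).trace ^ 2) (ω : ℤ → ι) :
    ∃ a b : ℤ → ℝ, (∀ k, a (k + 1) = F (ω k) (a k) - ε) ∧ (∀ k, b (k + 1) = F (ω k) (b k) + ε) ∧
      ∀ k, a k ≤ b k ∧ b k ≤ a k + Real.pi := by
  set P : ℤ → ℝ ≃ₜ ℝ := intProd fun k => translated F (-ε) (ω k) with hP
  set Q : ℤ → ℝ ≃ₜ ℝ := intProd fun k => translated F ε (ω k) with hQ
  have hPmem : ∀ k, P k ∈ degreeOneHomeo :=
    intProd_induction _ fun k => translated_mem_degreeOneHomeo hF _ _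
  have hQmem : ∀ k, Q k ∈ degreeOneHomeo :=
    intProd_induction _ fun k => translated_mem_degreeOneHomeo hF _ _
  -- A common translation by a multiple of `π` brings the first point into `[0, π]`; the second is
  -- at most `π` further on, hence the side `2π` of the box.
  let C : ℕ → Set (ℝ × ℝ) := fun N =>
    (Set.Icc 0 Real.pi ×ˢ Set.Icc 0 (2 * Real.pi)) ∩
      {p | ∀ k : ℤ, |k| ≤ N → P k p.1 ≤ Q k p.2 ∧ Q k p.2 ≤ P k p.1 + Real.pi}
  have hclosed : ∀ N, IsClosed (C N) := by
    intro N
    refine (isClosed_Icc.prod isClosed_Icc).inter ?_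
    simp only [Set.ofPred_forall]
    refine isClosed_iInter fun k => isClosed_iInter fun _ => ?_
    have h1 : Continuous fun p : ℝ × ℝ => P k p.1 := (P k).continuous.comp continuous_fst
    have h2 : Continuous fun p : ℝ × ℝ => Q k p.2 := (Q k).continuous.comp continuous_snd
    exact (isClosed_le h1 h2).inter (isClosed_le h2 (h1.add continuous_const))
  have hne : (⋂ N, C N).Nonempty := by
    refine IsCompact.nonempty_iInter_of_sequence_nonempty_isCompact_isClosed C ?_ ?_ ?_ hclosed
    · rintro N p ⟨hp, hp'⟩
      exact ⟨hp, fun k hk => hp' k (hk.trans (by push_cast; linarith))⟩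
    · intro N
      -- A window of length `2 * N` started at time `-N`, later read off at time `0`.
      obtain ⟨a, b, hab⟩ := exists_window hF hA hε (fun j => ω (-N + j)) (2 * N)
        (h _ _)
      obtain ⟨m, hm⟩ := exists_shift_mem_Ico 0 ((P (-N))⁻¹ a)
      have key : ∀ k : ℤ, |k| ≤ N → P k ((P (-N))⁻¹ a) ≤ Q k ((Q (-N))⁻¹ b) ∧
          Q k ((Q (-N))⁻¹ b) ≤ P k ((P (-N))⁻¹ a) + Real.pi := by
        intro k hk
        rw [abs_le] at hk
        obtain ⟨j, hj⟩ := Int.eq_ofNat_of_zero_le (show 0 ≤ k + N by linarith)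
        have hkj : k = -N + j := by
          change k + N = (j : ℤ) at hj
          linarith
        have h1 : P k ((P (-N))⁻¹ a) = seqProd (translated F (-ε)) (fun j => ω (-N + j)) j a := by
          rw [hP, hkj, intProd_add_natCast]
          exact congrArg _ (homeo_inv_apply _ _)
        have h2 : Q k ((Q (-N))⁻¹ b) = seqProd (translated F ε) (fun j => ω (-N + j)) j b := by
          rw [hQ, hkj, intProd_add_natCast]
          exact congrArg _ (homeo_inv_apply _ _)
        rw [h1, h2]
        exact hab j (by omega)
      have h0 := key 0 (by simp)
      have e0 : P 0 = 1 := rfl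
      have e1 : Q 0 = 1 := rfl
      rw [e0, e1] at h0
      change (P (-N))⁻¹ a ≤ (Q (-N))⁻¹ b ∧ (Q (-N))⁻¹ b ≤ (P (-N))⁻¹ a + Real.pi at h0
      rw [zero_add] at hm
      refine ⟨((P (-N))⁻¹ a + m * Real.pi, (Q (-N))⁻¹ b + m * Real.pi),
        ⟨Set.Ico_subset_Icc_self hm, ?_, ?_⟩, ?_⟩
      · have := hm.1
        simp only; linarith
      · have := hm.2
        simp only; linarith
      · intro k hk
        simp only [map_add_int_mul (hPmem k).2, map_add_int_mul (hQmem k).2]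
        have := key k hk
        constructor <;> linarith
    · exact (isCompact_Icc.prod isCompact_Icc).of_isClosed_subset (hclosed 0)
        Set.inter_subset_left
  obtain ⟨⟨p, q⟩, hpq⟩ := hne
  refine ⟨fun k => P k p, fun k => Q k q, fun k => ?_, fun k => ?_, fun k => ?_⟩
  · change P (k + 1) p = _
    rw [hP, intProd_add_one]; rfl
  · change Q (k + 1) q = _
    rw [hQ, intProd_add_one]; rfl
  · have := (Set.mem_iInter.1 hpq k.natAbs).2 k (by simp)
    exact this

lemma exists_between_antitone_monotone {f g : ℤ → ℝ} (hf : Antitone f) (hg : Monotone g)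
    (h : ∀ k, f k ≤ g k) : ∃ c, ∀ k, f k ≤ c ∧ c ≤ g k := by
  have hfg : ∀ k l, f k ≤ g l := by
    intro k l
    rcases le_total k l with hkl | hkl
    · exact (h k).trans (hg hkl)
    · exact (hf hkl).trans (h l)
  exact ⟨⨆ k, f k, fun k => ⟨le_ciSup ⟨g 0, by rintro _ ⟨l, rfl⟩; exact hfg l 0⟩ k,
    ciSup_le fun l => hfg l k⟩⟩

/-- Pulled back to time `0` by the unrotated system, the intervals `[a k, b k]` increase with `k`,
since `F` maps each one into the next. So they are nested towards `-∞` and share a point, the orbit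
`x`. The complementary intervals `[b k, a k + π]` are nested towards `+∞` and share the orbit `y`.
-/
lemma exists_orbits_between (hF : ∀ i, IsAngleLift (A i) (F i)) {ε : ℝ} (hε : 0 ≤ ε)
    {ω : ℤ → ι} {a b : ℤ → ℝ} (ha : ∀ k, a (k + 1) = F (ω k) (a k) - ε)
    (hb : ∀ k, b (k + 1) = F (ω k) (b k) + ε) (hab : ∀ k, a k ≤ b k ∧ b k ≤ a k + Real.pi) :
    ∃ x y : ℤ → ℝ, (∀ k, x (k + 1) = F (ω k) (x k)) ∧ (∀ k, y (k + 1) = F (ω k) (y k)) ∧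
      ∀ k, a k ≤ x k ∧ x k ≤ b k ∧ b k ≤ y k ∧ y k ≤ a k + Real.pi := by
  set P : ℤ → ℝ ≃ₜ ℝ := intProd fun k => F (ω k) with hP
  have hmem : ∀ k, P k ∈ degreeOneHomeo :=
    intProd_induction _ fun k => ⟨(hF _).strictMono, (hF _).map_add_pi⟩
  have hsucc : ∀ k z, P (k + 1) z = F (ω k) (P k z) := by
    intro k z
    rw [hP, intProd_add_one]; rfl
  have hle : ∀ k u v, P k u ≤ P k v ↔ u ≤ v := fun k u v => (hmem k).1.le_iff_le
  have hA : Antitone fun k => (P k)⁻¹ (a k) := antitone_int_of_succ_le fun k => by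
    rw [← hle (k + 1), homeo_inv_apply, hsucc, homeo_inv_apply, ha]
    linarith
  have hB : Monotone fun k => (P k)⁻¹ (b k) := monotone_int_of_le_succ fun k => by
    rw [← hle (k + 1), homeo_inv_apply, hsucc, homeo_inv_apply, hb]
    linarith
  obtain ⟨x, hx⟩ := exists_between_antitone_monotone hA hB fun k => by
    rw [← hle k, homeo_inv_apply, homeo_inv_apply]
    exact (hab k).1
  -- Time is reversed because the complementary intervals shrink in the other direction.
  obtain ⟨y, hy⟩ := exists_between_antitone_monotone
    (f := fun k => (P (-k))⁻¹ (b (-k))) (g := fun k => (P (-k))⁻¹ (a (-k)) + Real.pi)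
    (fun k l hkl => hB (neg_le_neg hkl)) (fun k l hkl => by
      have := hA (neg_le_neg hkl)
      simp only at this ⊢
      linarith) fun k => by
    rw [← hle (-k), homeo_inv_apply, (hmem _).2, homeo_inv_apply]
    exact (hab _).2
  refine ⟨fun k => P k x, fun k => P k y, fun k => hsucc k x, fun k => hsucc k y, fun k => ?_⟩
  obtain ⟨h1, h2⟩ := hx k
  obtain ⟨h3, h4⟩ := hy (-k)
  rw [neg_neg] at h3 h4
  rw [← hle k, homeo_inv_apply] at h1 h2 h3
  rw [← hle k, (hmem k).2, homeo_inv_apply] at h4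
  exact ⟨h1, h2, h3, h4⟩

/-- One step of the growth of the ratio of the cone forms along an expanded and a contracted
orbit. -/
lemma cone_form_step {ε a b x y a' b' x' y' s t s' t' D r r' : ℝ}
    (hx' : a' + ε ≤ x' ∧ x' ≤ b' - ε)
    (hy : b ≤ y ∧ y ≤ a + Real.pi) (hab : 2 * ε ≤ b - a ∧ b - a ≤ Real.pi)
    (hab' : b' - a' ≤ Real.pi)
    (hε : 0 ≤ ε) (hD : 0 < D) (hr : 0 < r) (hr' : 0 < r')
    (h1 : D * (s * Real.sin (x - a)) = r * s' * Real.sin (x' - a' - ε))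
    (h2 : D * (s * Real.sin (b - x)) = r' * s' * Real.sin (b' - x' - ε))
    (h3 : D * (t * Real.sin (y - a)) = r * t' * Real.sin (y' - a' - ε))
    (h4 : D * (t * Real.sin (y - b)) = r' * t' * Real.sin (y' - b' + ε)) :
    (1 + Real.sin ε ^ 2) ^ 2 * (s ^ 2 * (Real.sin (x - a) * Real.sin (b - x))) *
        (t' ^ 2 * (Real.sin (y' - a' - ε) * Real.sin (y' - b' + ε))) ≤
      s' ^ 2 * (Real.sin (x' - a') * Real.sin (b' - x')) *
        (t ^ 2 * (Real.sin (y - a - ε) * Real.sin (y - b + ε))) := by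
  set q := s ^ 2 * (Real.sin (x - a) * Real.sin (b - x)) with hq
  set q' := s' ^ 2 * (Real.sin (x' - a' - ε) * Real.sin (b' - x' - ε)) with hq'
  set p := t ^ 2 * (Real.sin (y - a) * Real.sin (y - b)) with hp
  set p' := t' ^ 2 * (Real.sin (y' - a' - ε) * Real.sin (y' - b' + ε)) with hp'
  set l := 1 + Real.sin ε ^ 2 with hl
  have hsin : 0 ≤ Real.sin ε := Real.sin_nonneg_of_nonneg_of_le_pi hε (by linarith)
  have eq : D ^ 2 * q = r * r' * q' := by
    rw [hq, hq']
    linear_combination (D * (s * Real.sin (b - x))) * h1 + r * s' * Real.sin (x' - a' - ε) * h2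
  have ep : D ^ 2 * p = r * r' * p' := by
    rw [hp, hp']
    linear_combination (D * (t * Real.sin (y - b))) * h3 + r * t' * Real.sin (y' - a' - ε) * h4
  -- The form of the cone is carried to the form of its image cone `[a' + ε, b' - ε]` with the same
  -- factor `D ^ 2 / (r * r')` at both vectors, so the factor cancels.
  have hcross : q * p' = p * q' := by
    have : (D ^ 2 * (r * r')) * (q * p') = (D ^ 2 * (r * r')) * (p * q') := by
      linear_combination r * r' * p' * eq - r * r' * q' * ep
    exact mul_left_cancel₀ (by positivity) this
  -- This compares the form of a cone with that of the cone cut by `ε` at both sides. By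
  -- `sin_mul_sin_sub` the difference depends on the vector only through `X + Y`, the opening of the
  -- cone.
  have hgain : ∀ X Y, Real.sin ε ≤ Real.sin (X + Y - ε) →
      Real.sin ε ^ 2 ≤ Real.sin X * Real.sin Y - Real.sin (X - ε) * Real.sin (Y - ε) := by
    intro X Y h
    rw [sin_mul_sin_sub, sq]
    exact mul_le_mul_of_nonneg_right h hsin
  have hle1 : ∀ X Y, Real.sin X * Real.sin Y ≤ 1 := fun X Y => by
    nlinarith [Real.neg_one_le_sin X, Real.sin_le_one X, Real.neg_one_le_sin Y, Real.sin_le_one Y]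
  -- Products of sines are at most `1`, so the additive gain `sin² ε` becomes the factor `l`. The
  -- same gain is used once more at `y`, where the form is negative; this explains the square of
  -- `l`.
  have hq'le : l * q' ≤ s' ^ 2 * (Real.sin (x' - a') * Real.sin (b' - x')) := by
    have h := hgain (x' - a') (b' - x') (sin_le_sin_of_mem hε (by linarith) (by linarith))
    have h' := hle1 (x' - a' - ε) (b' - x' - ε)
    rw [hq', mul_left_comm]
    refine mul_le_mul_of_nonneg_left ?_ (sq_nonneg _)
    nlinarith [sq_nonneg (Real.sin ε)]
  have hple : l * p ≤ t ^ 2 * (Real.sin (y - a - ε) * Real.sin (y - b + ε)) := by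
    have h := hgain (y - a) (b - y) (sin_le_sin_of_mem hε (by linarith) (by linarith))
    have h' := hle1 (y - a) (y - b)
    rw [show b - y = -(y - b) by ring, show -(y - b) - ε = -(y - b + ε) by ring, Real.sin_neg,
      Real.sin_neg] at h
    rw [hp, mul_left_comm]
    refine mul_le_mul_of_nonneg_left ?_ (sq_nonneg _)
    nlinarith [sq_nonneg (Real.sin ε)]
  have hp0 : 0 ≤ p := mul_nonneg (sq_nonneg _) (mul_nonneg
    (Real.sin_nonneg_of_nonneg_of_le_pi (by linarith) (by linarith))
    (Real.sin_nonneg_of_nonneg_of_le_pi (by linarith) (by linarith)))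
  have hl0 : 0 ≤ l := by positivity
  have hq0 : 0 ≤ q' := mul_nonneg (sq_nonneg _) (mul_nonneg
    (Real.sin_nonneg_of_nonneg_of_le_pi (by linarith) (by linarith))
    (Real.sin_nonneg_of_nonneg_of_le_pi (by linarith) (by linarith)))
  calc l ^ 2 * q * p' = (l * q') * (l * p) := by linear_combination l ^ 2 * hcross
    _ ≤ _ := mul_le_mul hq'le hple (mul_nonneg hl0 hp0) ((mul_nonneg hl0 hq0).trans hq'le)

end Cones

lemma pow_mul_le_of_step {q p : ℤ → ℝ} {L : ℝ} (hL : 0 ≤ L) (hp : ∀ k, 0 < p k)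
    (h : ∀ k, L * q k * p (k + 1) ≤ q (k + 1) * p k) (m : ℤ) (n : ℕ) :
    L ^ n * q m * p (m + n) ≤ q (m + n) * p m := by
  induction n with
  | zero => simp
  | succ n ih =>
    have h1 := h (m + n)
    rw [add_assoc] at h1
    push_cast
    refine le_of_mul_le_mul_right ?_ (hp (m + n))
    calc L ^ (n + 1) * q m * p (m + (n + 1)) * p (m + n)
        = (L ^ n * q m * p (m + n)) * (L * p (m + (n + 1))) := by ring
      _ ≤ (q (m + n) * p m) * (L * p (m + (n + 1))) :=
          mul_le_mul_of_nonneg_right ih (mul_nonneg hL (hp _).le)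
      _ = (L * q (m + n) * p (m + (n + 1))) * p m := by ring
      _ ≤ (q (m + (n + 1)) * p (m + n)) * p m := mul_le_mul_of_nonneg_right h1 (hp m).le
      _ = _ := by ring

/-! ### Expanded and contracted orbits -/

section Orbits

variable {ι : Type*} {A : ι → Matrix (Fin 2) (Fin 2) ℝ} {F : ι → ℝ ≃ₜ ℝ}

lemma exists_scale_of_orbit (hF : ∀ i, IsAngleLift (A i) (F i)) (hA : ∀ i, 0 < (A i).det)
    {ω : ℤ → ι} {Φ : ℤ → Matrix (Fin 2) (Fin 2) ℝ} (h0 : Φ 0 = 1)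
    (hΦ : ∀ k, Φ (k + 1) = A (ω k) * Φ k) {x : ℤ → ℝ} (hx : ∀ k, x (k + 1) = F (ω k) (x k)) :
    ∃ s : ℤ → ℝ, (∀ k, 0 < s k) ∧ (∀ k, (Φ k).mulVec (unitVec (x 0)) = s k • unitVec (x k)) ∧
      ∀ k, ∃ r : ℝ, (A (ω k)).mulVec (unitVec (x k)) = r • unitVec (x (k + 1)) ∧
        s (k + 1) = s k * r := by
  have key : ∀ k, ∃ s : ℝ, 0 < s ∧ (Φ k).mulVec (unitVec (x 0)) = s • unitVec (x k) := by
    intro k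
    induction k using Int.induction_on with
    | zero => exact ⟨1, one_pos, by rw [h0, Matrix.one_mulVec, one_smul]⟩
    | succ n ih =>
      obtain ⟨s, hs, h⟩ := ih
      obtain ⟨r, hr, h'⟩ := (hF (ω n)).map_unitVec (x n)
      refine ⟨s * r, by positivity, ?_⟩
      rw [hΦ, ← Matrix.mulVec_mulVec, h, Matrix.mulVec_smul, h', smul_smul, hx]
    | pred n ih =>
      obtain ⟨s, hs, h⟩ := ih
      obtain ⟨r, hr, h'⟩ := (hF (ω (-n - 1))).map_unitVec (x (-n - 1))
      have h1 := hΦ (-n - 1)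
      have h2 := hx (-n - 1)
      rw [sub_add_cancel] at h1 h2
      refine ⟨s / r, by positivity, ?_⟩
      apply Matrix.mulVec_injective_iff_isUnit.2
        ((Matrix.isUnit_iff_isUnit_det _).2 (hA (ω (-n - 1))).ne'.isUnit)
      rw [Matrix.mulVec_mulVec, ← h1, h, Matrix.mulVec_smul, h', smul_smul, ← h2,
        div_mul_cancel₀ _ hr.ne']
  choose s hs hs' using key
  refine ⟨s, hs, hs', fun k => ?_⟩
  obtain ⟨r, hr, h⟩ := (hF (ω k)).map_unitVec (x k)
  rw [← hx] at h
  refine ⟨r, h, ?_⟩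
  have h1 := hs' (k + 1)
  rw [hΦ, ← Matrix.mulVec_mulVec, hs', Matrix.mulVec_smul, h, smul_smul] at h1
  have h2 : s k * r * Real.cos (x (k + 1)) = s (k + 1) * Real.cos (x (k + 1)) := by
    simpa [unitVec] using congrFun h1 0
  have h3 : s k * r * Real.sin (x (k + 1)) = s (k + 1) * Real.sin (x (k + 1)) := by
    simpa [unitVec] using congrFun h1 1
  have h4 := Real.sin_sq_add_cos_sq (x (k + 1))
  linear_combination (s k * r - s (k + 1)) * h4 - Real.cos (x (k + 1)) * h2 -
    Real.sin (x (k + 1)) * h3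

/-- If no product of the slightly rotated matrices has an elliptic trace, every two-sided sequence
of symbols has an expanded and a contracted orbit, with uniform constants. -/
lemma exists_dominated_orbits (hF : ∀ i, IsAngleLift (A i) (F i)) (hA : ∀ i, 0 < (A i).det) {ε : ℝ}
    (hε : 0 < ε)
    (h : ∀ x n, ∀ θ ∈ Set.Icc (-ε) ε, 4 * (seqProd (fun i => rotMat θ * A i) x n).det ≤
      (seqProd (fun i => rotMat θ * A i) x n).trace ^ 2) (ω : ℤ → ι)
    {Φ : ℤ → Matrix (Fin 2) (Fin 2) ℝ} (h0 : Φ 0 = 1) (hΦ : ∀ k, Φ (k + 1) = A (ω k) * Φ k) :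
    ∃ x y s t : ℤ → ℝ, (∀ k, 0 < s k) ∧ (∀ k, 0 < t k) ∧
      (∀ k, (Φ k).mulVec (unitVec (x 0)) = s k • unitVec (x k)) ∧
      (∀ k, (Φ k).mulVec (unitVec (y 0)) = t k • unitVec (y k)) ∧
      0 < Real.sin ε ∧ (∀ k, Real.sin ε ≤ Real.sin (y k - x k)) ∧
      ∀ (m : ℤ) (n : ℕ), ((1 + Real.sin ε ^ 2) ^ 2) ^ n * Real.sin ε ^ 4 *
        (s m ^ 2 * t (m + n) ^ 2) ≤ s (m + n) ^ 2 * t m ^ 2 := by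
  obtain ⟨a, b, ha, hb, hab⟩ := exists_cone_sequence hF hA hε.le h ω
  obtain ⟨x, y, hx, hy, hxy⟩ := exists_orbits_between hF hε.le ha hb hab
  obtain ⟨s, hs, hsΦ, hs'⟩ := exists_scale_of_orbit hF hA h0 hΦ hx
  obtain ⟨t, ht, htΦ, ht'⟩ := exists_scale_of_orbit hF hA h0 hΦ hy
  have hmono : ∀ i, Monotone (F i) := fun i => (hF i).strictMono.monotone
  -- The cone at time `k` contains the image of the cone at time `k - 1` with a margin `ε` on both
  -- sides; this uses that the sequences extend to the past.
  have hlen : ∀ k, 2 * ε ≤ b k - a k := by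
    intro k
    have h1 := ha (k - 1)
    have h2 := hb (k - 1)
    have h3 := hmono (ω (k - 1)) (hab (k - 1)).1
    rw [sub_add_cancel] at h1 h2
    linarith
  have hxin : ∀ k, a k + ε ≤ x k ∧ x k ≤ b k - ε := by
    intro k
    have h1 := ha (k - 1)
    have h2 := hb (k - 1)
    have h3 := hx (k - 1)
    have h4 := hmono (ω (k - 1)) (hxy (k - 1)).1
    have h5 := hmono (ω (k - 1)) (hxy (k - 1)).2.1
    rw [sub_add_cancel] at h1 h2 h3
    constructor <;> linarith
  have hsin : 0 < Real.sin ε := by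
    have h1 := hlen 0
    have h2 := (hab 0).2
    exact Real.sin_pos_of_pos_of_lt_pi hε (by linarith)
  -- At `x` the form of the whole cone is used, at `y` minus the form of the cone cut by `ε`. Each
  -- vector then has angle at least `ε` to the sides, so both forms are comparable to the squared
  -- length.
  set q : ℤ → ℝ := fun k => s k ^ 2 * (Real.sin (x k - a k) * Real.sin (b k - x k)) with hq
  set p : ℤ → ℝ := fun k => t k ^ 2 * (Real.sin (y k - a k - ε) * Real.sin (y k - b k + ε)) with hp
  have hlow : ∀ X Y, Real.sin ε ≤ Real.sin X → Real.sin ε ≤ Real.sin Y →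
      Real.sin ε ^ 2 ≤ Real.sin X * Real.sin Y := by
    intro X Y hX hY
    rw [sq]
    exact mul_le_mul hX hY hsin.le (hsin.le.trans hX)
  have hle1 : ∀ X Y, Real.sin X * Real.sin Y ≤ 1 := fun X Y => by
    nlinarith [Real.neg_one_le_sin X, Real.sin_le_one X, Real.neg_one_le_sin Y, Real.sin_le_one Y]
  have hqlow : ∀ k, Real.sin ε ^ 2 * s k ^ 2 ≤ q k := fun k => by
    have h1 := hxin k
    have h2 := hab k
    rw [hq, mul_comm]
    exact mul_le_mul_of_nonneg_left (hlow _ _ (sin_le_sin_of_mem hε.le (by linarith) (by linarith))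
      (sin_le_sin_of_mem hε.le (by linarith) (by linarith))) (sq_nonneg _)
  have hplow : ∀ k, Real.sin ε ^ 2 * t k ^ 2 ≤ p k := fun k => by
    have h1 := hlen k
    have h2 := hxy k
    rw [hp, mul_comm]
    exact mul_le_mul_of_nonneg_left (hlow _ _ (sin_le_sin_of_mem hε.le (by linarith) (by linarith))
      (sin_le_sin_of_mem hε.le (by linarith) (by linarith))) (sq_nonneg _)
  have hqup : ∀ k, q k ≤ s k ^ 2 := fun k => mul_le_of_le_one_right (sq_nonneg _) (hle1 _ _)
  have hpup : ∀ k, p k ≤ t k ^ 2 := fun k => mul_le_of_le_one_right (sq_nonneg _) (hle1 _ _)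
  have hp0 : ∀ k, 0 < p k := fun k =>
    lt_of_lt_of_le (by have := ht k; positivity) (hplow k)
  have hq0 : ∀ k, 0 < q k := fun k =>
    lt_of_lt_of_le (by have := hs k; positivity) (hqlow k)
  have hstep : ∀ k, (1 + Real.sin ε ^ 2) ^ 2 * q k * p (k + 1) ≤ q (k + 1) * p k := by
    intro k
    obtain ⟨r, hr, hMa⟩ := (hF (ω k)).map_unitVec (a k)
    obtain ⟨r', hr', hMb⟩ := (hF (ω k)).map_unitVec (b k)
    obtain ⟨u, hMx, hu⟩ := hs' k
    obtain ⟨v, hMy, hv⟩ := ht' k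
    refine cone_form_step (hxin (k + 1)) ⟨(hxy k).2.2.1, (hxy k).2.2.2⟩
      ⟨hlen k, by linarith [(hab k).2]⟩ (by linarith [(hab (k + 1)).2]) hε.le (hA (ω k)) hr hr'
      ?_ ?_ ?_ ?_
    · rw [hu, show x (k + 1) - a (k + 1) - ε = x (k + 1) - F (ω k) (a k) by rw [ha]; ring]
      linear_combination s k * det_mul_sin hMa hMx
    · rw [hu, show b (k + 1) - x (k + 1) - ε = F (ω k) (b k) - x (k + 1) by rw [hb]; ring]
      linear_combination s k * det_mul_sin hMx hMb
    · rw [hv, show y (k + 1) - a (k + 1) - ε = y (k + 1) - F (ω k) (a k) by rw [ha]; ring]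
      linear_combination t k * det_mul_sin hMa hMy
    · rw [hv, show y (k + 1) - b (k + 1) + ε = y (k + 1) - F (ω k) (b k) by rw [hb]; ring]
      linear_combination t k * det_mul_sin hMb hMy
  refine ⟨x, y, s, t, hs, ht, hsΦ, htΦ, hsin, fun k => ?_, fun m n => ?_⟩
  · have h1 := hxin k
    have h2 := hxy k
    exact sin_le_sin_of_mem hε.le (by linarith) (by linarith)
  · have h1 := pow_mul_le_of_step (sq_nonneg _) hp0 hstep m n
    calc _ = ((1 + Real.sin ε ^ 2) ^ 2) ^ n * (Real.sin ε ^ 2 * s m ^ 2) *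
          (Real.sin ε ^ 2 * t (m + n) ^ 2) := by ring
      _ ≤ ((1 + Real.sin ε ^ 2) ^ 2) ^ n * q m * p (m + n) := by
          have := (hq0 m).le
          gcongr
          · exact hqlow m
          · exact hplow _
      _ ≤ q (m + n) * p m := h1
      _ ≤ _ := mul_le_mul (hqup _) (hpup _) (hp0 _).le (sq_nonneg _)

end Orbits

/-! ### Invariant directions defined by the growth of orbits -/

section SlowSpace

variable {E : Type*} [NormedAddCommGroup E] [NormedSpace ℝ E]

/-- The vectors whose orbit under `Φ` is, along `l`, dominated by every other nonzero orbit. -/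
def slowSpace (Φ : ℤ → E →L[ℝ] E) (l : Filter ℤ) : Submodule ℝ E where
  carrier := {p | ∀ q ≠ 0, ∃ C : ℝ, ∀ᶠ k in l, ‖Φ k p‖ ≤ C * ‖Φ k q‖}
  add_mem' := by
    intro p p' hp hp' q hq
    obtain ⟨C, hC⟩ := hp q hq
    obtain ⟨C', hC'⟩ := hp' q hq
    refine ⟨C + C', ?_⟩
    filter_upwards [hC, hC'] with k h h'
    rw [map_add, add_mul]
    exact (norm_add_le _ _).trans (add_le_add h h')
  zero_mem' := fun q _ => ⟨0, by simp⟩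
  smul_mem' := by
    intro c p hp q hq
    obtain ⟨C, hC⟩ := hp q hq
    refine ⟨|c| * C, ?_⟩
    filter_upwards [hC] with k h
    rw [map_smul, norm_smul, Real.norm_eq_abs, mul_assoc]
    exact mul_le_mul_of_nonneg_left h (abs_nonneg c)

/-- A vector with nonzero component along `v` grows at least like `v`, which outgrows `w` along `l`;
so only multiples of `w` are dominated by every nonzero orbit. -/
lemma slowSpace_eq_span {Φ : ℤ → E →L[ℝ] E} {l : Filter ℤ} [l.NeBot] {v w : E} {κ : ℝ}
    (hκ : 0 < κ) (hspan : ∀ p, ∃ α β : ℝ, p = α • v + β • w)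
    (hv : ∀ k (α β : ℝ), κ * (|α| * ‖Φ k v‖) ≤ ‖Φ k (α • v + β • w)‖)
    (hw : ∀ k, 0 < ‖Φ k w‖)
    (hlim : Filter.Tendsto (fun k => ‖Φ k v‖ / ‖Φ k w‖) l Filter.atTop) :
    slowSpace Φ l = Submodule.span ℝ {w} := by
  apply le_antisymm
  · intro p hp
    obtain ⟨α, β, rfl⟩ := hspan p
    have hw0 : w ≠ 0 := by
      rintro rfl
      simpa using hw 0
    obtain ⟨C, hC⟩ := hp w hw0
    have hα : α = 0 := by
      by_contra hα
      obtain ⟨k, h1, h2⟩ := (hC.and (hlim.eventually_gt_atTop (C / (κ * |α|)))).exists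
      have h3 := (hv k α β).trans h1
      rw [lt_div_iff₀ (hw k), div_mul_eq_mul_div, div_lt_iff₀ (by positivity)] at h2
      linarith
    rw [hα, zero_smul, zero_add]
    exact Submodule.smul_mem _ _ (Submodule.mem_span_singleton_self w)
  · rw [Submodule.span_singleton_le_iff_mem]
    intro q hq
    obtain ⟨α, β, rfl⟩ := hspan q
    rcases eq_or_ne α 0 with rfl | hα
    · rw [zero_smul, zero_add] at hq ⊢
      have hβ : β ≠ 0 := fun h => hq (by rw [h, zero_smul])
      refine ⟨|β|⁻¹, Filter.Eventually.of_forall fun k => ?_⟩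
      rw [map_smul, norm_smul, Real.norm_eq_abs, inv_mul_cancel_left₀ (abs_ne_zero.2 hβ)]
    · refine ⟨(κ * |α|)⁻¹, ?_⟩
      filter_upwards [hlim.eventually_ge_atTop 1] with k hk
      rw [le_div_iff₀ (hw k), one_mul] at hk
      rw [← div_eq_inv_mul, le_div_iff₀ (by positivity)]
      have := hv k α β
      calc _ = κ * (|α| * ‖Φ k w‖) := by ring
        _ ≤ κ * (|α| * ‖Φ k v‖) := by gcongr
        _ ≤ _ := this

/-- The slow space depends only on the orbit along `l`, and `L` replaces an orbit by the same orbit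
one step later. A filter invariant under the unit shift does not see the difference. -/
lemma map_slowSpace {Φ Φ' : ℤ → E →L[ℝ] E} {l : Filter ℤ} {L : E →L[ℝ] E}
    (hL : Function.Bijective L) (h : ∀ k p, Φ' k (L p) = Φ (k + 1) p)
    (hl : Filter.map (· + 1) l = l) :
    (slowSpace Φ l).map L.toLinearMap = slowSpace Φ' l := by
  have key : slowSpace Φ l = (slowSpace Φ' l).comap L.toLinearMap := by
    ext p
    change (∀ q ≠ 0, ∃ C : ℝ, ∀ᶠ k in l, ‖Φ k p‖ ≤ C * ‖Φ k q‖) ↔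
      ∀ q ≠ 0, ∃ C : ℝ, ∀ᶠ k in l, ‖Φ' k (L p)‖ ≤ C * ‖Φ' k q‖
    have hshift : ∀ q, (∃ C : ℝ, ∀ᶠ k in l, ‖Φ k p‖ ≤ C * ‖Φ k q‖) ↔
        ∃ C : ℝ, ∀ᶠ k in l, ‖Φ' k (L p)‖ ≤ C * ‖Φ' k (L q)‖ := by
      intro q
      refine exists_congr fun C => ?_
      simp only [h]
      conv_lhs => rw [← hl]
      exact Filter.eventually_map
    constructor
    · intro hp q hq
      obtain ⟨q, rfl⟩ := hL.2 q
      exact (hshift q).1 (hp q (by rintro rfl; simp at hq))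
    · intro hp q hq
      exact (hshift q).2 (hp (L q) fun h0 => hq (hL.1 (by rw [h0, map_zero])))
  rw [key, Submodule.map_comap_eq_of_surjective]
  exact hL.2

lemma norm_comp_subtypeL_span {v : E} (hv : ‖v‖ = 1) (L : E →L[ℝ] E) {S : Submodule ℝ E}
    (hS : S = Submodule.span ℝ {v}) : ‖L.comp S.subtypeL‖ = ‖L v‖ := by
  subst hS
  apply le_antisymm
  · refine ContinuousLinearMap.opNorm_le_bound _ (norm_nonneg _) ?_
    rintro ⟨x, hx⟩
    obtain ⟨c, rfl⟩ := Submodule.mem_span_singleton.1 hx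
    simp [norm_smul, hv, mul_comm]
  · have := (L.comp (Submodule.span ℝ {v}).subtypeL).le_opNorm
      ⟨v, Submodule.mem_span_singleton_self v⟩
    simpa [hv] using this

end SlowSpace

lemma euclOp_apply (g : GL (Fin 2) ℝ) (v : Fin 2 → ℝ) :
    euclOp g (WithLp.toLp 2 v) = WithLp.toLp 2 ((g : Matrix (Fin 2) (Fin 2) ℝ).mulVec v) := rfl

lemma euclOp_mul_apply (g h : GL (Fin 2) ℝ) (v : EuclideanSpace ℝ (Fin 2)) :
    euclOp (g * h) v = euclOp g (euclOp h v) := by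
  simp [euclOp]

lemma euclOp_one_apply (v : EuclideanSpace ℝ (Fin 2)) : euclOp 1 v = v := by
  simp [euclOp]

lemma euclOp_bijective (g : GL (Fin 2) ℝ) : Function.Bijective (euclOp g) :=
  Function.bijective_iff_has_inverse.2 ⟨euclOp g⁻¹, fun v => by
    rw [← euclOp_mul_apply, inv_mul_cancel, euclOp_one_apply], fun v => by
    rw [← euclOp_mul_apply, mul_inv_cancel, euclOp_one_apply]⟩

lemma norm_toLp_unitVec (x : ℝ) : ‖(WithLp.toLp 2 (unitVec x) : EuclideanSpace ℝ (Fin 2))‖ = 1 := by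
  rw [EuclideanSpace.norm_eq]
  simp [unitVec, Fin.sum_univ_two]

/-- The left side is the distance from the vector to the line spanned by `unitVec y`. -/
lemma abs_mul_sin_le_norm (c d x y : ℝ) :
    |c| * |Real.sin (y - x)| ≤
      ‖(WithLp.toLp 2 (c • unitVec x + d • unitVec y) : EuclideanSpace ℝ (Fin 2))‖ := by
  rw [EuclideanSpace.norm_eq, ← abs_mul]
  apply Real.abs_le_sqrt
  simp only [unitVec, Fin.sum_univ_two, Pi.add_apply, Pi.smul_apply, Matrix.cons_val_zero,
    Matrix.cons_val_one, smul_eq_mul, Real.norm_eq_abs, sq_abs]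
  have h1 := Real.sin_sq_add_cos_sq y
  rw [Real.sin_sub]
  have : 0 ≤ ((c * Real.cos x + d * Real.cos y) * Real.cos y +
    (c * Real.sin x + d * Real.sin y) * Real.sin y) ^ 2 := sq_nonneg _
  have e : (c * Real.cos x + d * Real.cos y) ^ 2 + (c * Real.sin x + d * Real.sin y) ^ 2 =
      (c * (Real.sin y * Real.cos x - Real.cos y * Real.sin x)) ^ 2 +
      ((c * Real.cos x + d * Real.cos y) * Real.cos y +
    (c * Real.sin x + d * Real.sin y) * Real.sin y) ^ 2 := by
    linear_combination (-(c * Real.cos x + d * Real.cos y) ^ 2 -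
      (c * Real.sin x + d * Real.sin y) ^ 2) * h1
  linarith

lemma exists_combination {x y : ℝ} (h : Real.sin (y - x) ≠ 0) (p : EuclideanSpace ℝ (Fin 2)) :
    ∃ α β : ℝ, p = α • WithLp.toLp 2 (unitVec x) + β • WithLp.toLp 2 (unitVec y) := by
  refine ⟨(p 0 * Real.sin y - p 1 * Real.cos y) / Real.sin (y - x),
    (p 1 * Real.cos x - p 0 * Real.sin x) / Real.sin (y - x), ?_⟩
  ext i
  rw [Real.sin_sub] at h ⊢
  fin_cases i
  · simp [unitVec]
    field_simp
    ring
  · simp [unitVec]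
    field_simp
    ring

lemma intProd_shift {G : Type*} [Group G] (f : ℤ → G) (k : ℤ) :
    intProd (fun j => f (j + 1)) k * f 0 = intProd f (k + 1) := by
  induction k using Int.induction_on with
  | zero => rw [intProd_add_one]; simp [intProd_zero]
  | succ n ih => rw [intProd_add_one, mul_assoc, ih, intProd_add_one f (n + 1)]
  | pred n ih =>
    have h1 := intProd_add_one (fun j => f (j + 1)) (-n - 1)
    have h2 := intProd_add_one f (-n - 1 + 1)
    rw [sub_add_cancel] at h1 h2
    rw [h1, h2, mul_assoc] at ih
    rw [sub_add_cancel]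
    exact mul_left_cancel ih

/-! ### Absence of elliptic products implies domination -/

section Domination

variable {k : ℕ} (A : Fin k → GL(2, ℝ)⁺)

lemma fullShift_iterate_apply (n : ℕ) (ω : ℤ → Fin k) (j : ℤ) :
    (fullShift k)^[n] ω j = ω (j + n) := by
  induction n generalizing ω with
  | zero => simp
  | succ n ih =>
    rw [Function.iterate_succ_apply, ih]
    change ω (j + n + 1) = _
    push_cast
    rw [add_assoc]

lemma cocycleProd_eq_seqProd (n : ℕ) (ω : ℤ → Fin k) :
    cocycleProd (fullShift k) (oneStep A) n ω =
      seqProd (fun i => (A i : GL (Fin 2) ℝ)) (fun j => ω j) n := by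
  induction n with
  | zero => rfl
  | succ n ih =>
    rw [cocycleProd, ih, seqProd, oneStep, fullShift_iterate_apply, zero_add]

/-- The two-sided products as operators of the plane. -/
noncomputable def orbitOp (ω : ℤ → Fin k) (n : ℤ) :
    EuclideanSpace ℝ (Fin 2) →L[ℝ] EuclideanSpace ℝ (Fin 2) :=
  euclOp (intProd (fun j => (A (ω j) : GL (Fin 2) ℝ)) n)

lemma tendsto_ratio_atTop {f : ℕ → ℝ} {L c : ℝ} (hL : 1 < L) (hc : 0 < c) (hf : ∀ n, 0 ≤ f n)
    (h : ∀ n, L ^ n * c ≤ f n ^ 2) : Filter.Tendsto f Filter.atTop Filter.atTop := by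
  have h1 : Filter.Tendsto (fun n => √(L ^ n * c)) Filter.atTop Filter.atTop :=
    Real.tendsto_sqrt_atTop.comp ((tendsto_pow_atTop_atTop_of_one_lt hL).atTop_mul_const hc)
  exact Filter.tendsto_atTop_mono (fun n => Real.sqrt_le_iff.2 ⟨hf n, h n⟩) h1

/-- The orbits of `exists_dominated_orbits` are chosen separately for each word. Identifying their
directions with slow spaces in the past and in the future removes the choice, and equivariance
follows. -/
theorem isDominated_of_no_elliptic (hk : 0 < k) {ε : ℝ} (hε : 0 < ε)
    (h : ∀ x n, ∀ θ ∈ Set.Icc (-ε) ε,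
      4 * (seqProd (fun i => rotMat θ * ((A i : GL (Fin 2) ℝ) : Matrix _ _ ℝ)) x n).det ≤
      (seqProd (fun i => rotMat θ * ((A i : GL (Fin 2) ℝ) : Matrix _ _ ℝ)) x n).trace ^ 2) :
    IsDominated (fullShift k) (oneStep A) := by
  have hA : ∀ i, 0 < ((A i : GL (Fin 2) ℝ) : Matrix (Fin 2) (Fin 2) ℝ).det := fun i => (A i).2
  choose F hF using fun i => exists_isAngleLift (hA i)
  have key : ∀ ω : ℤ → Fin k, ∃ x y s t : ℤ → ℝ, (∀ k, 0 < s k) ∧ (∀ k, 0 < t k) ∧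
      (∀ k, orbitOp A ω k (WithLp.toLp 2 (unitVec (x 0))) = WithLp.toLp 2 (s k • unitVec (x k))) ∧
      (∀ k, orbitOp A ω k (WithLp.toLp 2 (unitVec (y 0))) = WithLp.toLp 2 (t k • unitVec (y k))) ∧
      0 < Real.sin ε ∧ (∀ k, Real.sin ε ≤ Real.sin (y k - x k)) ∧
      ∀ (m : ℤ) (n : ℕ), ((1 + Real.sin ε ^ 2) ^ 2) ^ n * Real.sin ε ^ 4 *
        (s m ^ 2 * t (m + n) ^ 2) ≤ s (m + n) ^ 2 * t m ^ 2 := by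
    intro ω
    obtain ⟨x, y, s, t, hs, ht, hsx, hty, h'⟩ := exists_dominated_orbits hF hA hε h ω
      (Φ := fun n => (intProd (fun j => (A (ω j) : GL (Fin 2) ℝ)) n : GL (Fin 2) ℝ))
      (by rw [intProd_zero]; rfl) (fun k => by rw [intProd_add_one]; rfl)
    refine ⟨x, y, s, t, hs, ht, fun k => ?_, fun k => ?_, h'⟩
    · rw [orbitOp, euclOp_apply, hsx]
    · rw [orbitOp, euclOp_apply, hty]
  have hnorm : ∀ (c : ℝ) (z : ℝ), 0 < c →
      ‖(WithLp.toLp 2 (c • unitVec z) : EuclideanSpace ℝ (Fin 2))‖ = c := by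
    intro c z hc
    rw [WithLp.toLp_smul, norm_smul, norm_toLp_unitVec, mul_one, Real.norm_eq_abs, abs_of_pos hc]
  have key' : ∀ ω : ℤ → Fin k, ∃ v w : EuclideanSpace ℝ (Fin 2), ‖v‖ = 1 ∧ ‖w‖ = 1 ∧
      (∀ p, ∃ α β : ℝ, p = α • v + β • w) ∧
      slowSpace (orbitOp A ω) Filter.atBot = Submodule.span ℝ {v} ∧
      slowSpace (orbitOp A ω) Filter.atTop = Submodule.span ℝ {w} ∧
      (∀ α β : ℝ, α • v + β • w = 0 → α = 0 ∧ β = 0) ∧ 0 < Real.sin ε ∧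
      ∀ n : ℕ, Real.sin ε ^ 2 * (1 + Real.sin ε ^ 2) ^ n ≤
        ‖orbitOp A ω n v‖ / ‖orbitOp A ω n w‖ := by
    intro ω
    obtain ⟨x, y, s, t, hs, ht, hsx, hty, hsin, hang, hgrow⟩ := key ω
    have hvn : ∀ k, ‖orbitOp A ω k (WithLp.toLp 2 (unitVec (x 0)))‖ = s k := fun k => by
      rw [hsx, hnorm _ _ (hs k)]
    have hwn : ∀ k, ‖orbitOp A ω k (WithLp.toLp 2 (unitVec (y 0)))‖ = t k := fun k => by
      rw [hty, hnorm _ _ (ht k)]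
    have hone : ∀ p, orbitOp A ω 0 p = p := fun p => by
      rw [orbitOp, intProd_zero, euclOp_one_apply]
    have hs0 : s 0 = 1 := by rw [← hvn, hone, norm_toLp_unitVec]
    have ht0 : t 0 = 1 := by rw [← hwn, hone, norm_toLp_unitVec]
    have hsin0 : Real.sin (y 0 - x 0) ≠ 0 := (hsin.trans_le (hang 0)).ne'
    have hcomb : ∀ k (α β : ℝ), orbitOp A ω k (α • WithLp.toLp 2 (unitVec (x 0)) +
        β • WithLp.toLp 2 (unitVec (y 0))) =
        WithLp.toLp 2 ((α * s k) • unitVec (x k) + (β * t k) • unitVec (y k)) := by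
      intro k α β
      rw [map_add, map_smul, map_smul, hsx, hty, ← WithLp.toLp_smul, ← WithLp.toLp_smul,
        ← WithLp.toLp_add, smul_smul, smul_smul]
    have hlow : ∀ k (α β : ℝ), Real.sin ε * (|α| * ‖orbitOp A ω k (WithLp.toLp 2 (unitVec (x 0)))‖)
        ≤ ‖orbitOp A ω k (α • WithLp.toLp 2 (unitVec (x 0)) +
        β • WithLp.toLp 2 (unitVec (y 0)))‖ := by
      intro k α β
      rw [hcomb, hvn]
      refine le_trans ?_ (abs_mul_sin_le_norm _ _ _ _)
      rw [abs_mul, abs_of_pos (hs k), mul_comm]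
      have := hs k
      exact mul_le_mul_of_nonneg_left ((hang k).trans (le_abs_self _)) (by positivity)
    have hlow' : ∀ k (β α : ℝ), Real.sin ε * (|β| * ‖orbitOp A ω k (WithLp.toLp 2 (unitVec (y 0)))‖)
        ≤ ‖orbitOp A ω k (β • WithLp.toLp 2 (unitVec (y 0)) +
        α • WithLp.toLp 2 (unitVec (x 0)))‖ := by
      intro k β α
      rw [add_comm, hcomb, hwn, add_comm]
      refine le_trans ?_ (abs_mul_sin_le_norm _ _ _ _)
      rw [abs_mul, abs_of_pos (ht k), mul_comm, ← neg_sub, Real.sin_neg, abs_neg]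
      have := ht k
      exact mul_le_mul_of_nonneg_left ((hang k).trans (le_abs_self _)) (by positivity)
    have hL : 1 < (1 + Real.sin ε ^ 2) ^ 2 := one_lt_pow₀ (by nlinarith) two_ne_zero
    refine ⟨WithLp.toLp 2 (unitVec (x 0)), WithLp.toLp 2 (unitVec (y 0)), norm_toLp_unitVec _,
      norm_toLp_unitVec _, exists_combination hsin0, ?_, ?_, ?_, hsin, ?_⟩
    · refine slowSpace_eq_span hsin (fun p => ?_) hlow' (fun k => by rw [hvn]; exact hs k) ?_
      · obtain ⟨α, β, hp⟩ := exists_combination hsin0 p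
        exact ⟨β, α, by rw [hp, add_comm]⟩
      · simp only [hvn, hwn]
        rw [← Filter.map_neg_atTop, Filter.tendsto_map'_iff, ← Nat.map_cast_int_atTop,
          Filter.tendsto_map'_iff]
        refine tendsto_ratio_atTop (c := Real.sin ε ^ 4) hL (by positivity)
          (fun n => (div_pos (ht _) (hs _)).le) fun n => ?_
        -- Growth from time `-n` to time `0`, where both scales are `1`: in the past it is the
        -- expanded orbit that is the smaller one.
        have h1 := hgrow (-n) n
        rw [neg_add_cancel, hs0, ht0, one_pow, one_mul, mul_one] at h1
        have h2 := hs (-n)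
        simp only [Function.comp]
        rw [div_pow, le_div_iff₀ (by positivity)]
        exact h1
    · refine slowSpace_eq_span hsin (exists_combination hsin0) hlow
        (fun k => by rw [hwn]; exact ht k) ?_
      simp only [hvn, hwn]
      rw [← Nat.map_cast_int_atTop, Filter.tendsto_map'_iff]
      refine tendsto_ratio_atTop (c := Real.sin ε ^ 4) hL (by positivity)
        (fun n => (div_pos (hs _) (ht _)).le) fun n => ?_
      have h1 := hgrow 0 n
      rw [zero_add, hs0, ht0, one_pow, one_mul, mul_one] at h1
      have h2 := ht n
      simp only [Function.comp]
      rw [div_pow, le_div_iff₀ (by positivity)]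
      exact h1
    · intro α β h0
      have h1 := hlow 0 α β
      have h2 := hlow' 0 β α
      rw [add_comm] at h2
      rw [h0, hvn, hs0, map_zero, norm_zero] at h1
      rw [h0, hwn, ht0, map_zero, norm_zero] at h2
      constructor
      · by_contra hα
        have : 0 < Real.sin ε * (|α| * 1) := by positivity
        linarith
      · by_contra hβ
        have : 0 < Real.sin ε * (|β| * 1) := by positivity
        linarith
    · intro n
      have h1 := hgrow 0 n
      rw [zero_add, hs0, ht0, one_pow, one_mul, mul_one] at h1
      rw [hvn, hwn, le_div_iff₀ (ht _)]
      have h2 := ht n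
      refine le_of_sq_le_sq ?_ (hs n).le
      calc _ = ((1 + Real.sin ε ^ 2) ^ 2) ^ n * Real.sin ε ^ 4 * t n ^ 2 := by
            rw [mul_pow, mul_pow, ← pow_mul, ← pow_mul, ← pow_mul, mul_comm n 2]
            ring
        _ ≤ _ := h1
  have hshift : ∀ (ω : ℤ → Fin k) (n : ℤ) p,
      orbitOp A (fullShift k ω) n (euclOp (oneStep A ω) p) = orbitOp A ω (n + 1) p := by
    intro ω n p
    rw [orbitOp, orbitOp, ← euclOp_mul_apply, ← intProd_shift]
    rfl
  have hmap : Filter.map (fun n : ℤ => n + 1) Filter.atTop = Filter.atTop :=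
    (OrderIso.addRight (1 : ℤ)).map_atTop
  have hmap' : Filter.map (fun n : ℤ => n + 1) Filter.atBot = Filter.atBot :=
    (OrderIso.addRight (1 : ℤ)).map_atBot
  have hne : ∀ v : EuclideanSpace ℝ (Fin 2), ‖v‖ = 1 → v ≠ 0 := by
    rintro _ h1 rfl
    simp at h1
  refine ⟨fun ω => slowSpace (orbitOp A ω) Filter.atBot,
    fun ω => slowSpace (orbitOp A ω) Filter.atTop, ?_, ?_, ?_, ?_, ?_, ?_⟩
  · intro ω
    obtain ⟨v, w, hv, hw, -, h1, h2, -⟩ := key' ω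
    rw [h1]
    exact finrank_span_singleton (hne v hv)
  · intro ω
    obtain ⟨v, w, hv, hw, -, h1, h2, -⟩ := key' ω
    rw [h2]
    exact finrank_span_singleton (hne w hw)
  · intro ω
    obtain ⟨v, w, hv, hw, hsp, h1, h2, hind, -⟩ := key' ω
    rw [h1, h2]
    constructor
    · rw [Submodule.disjoint_def]
      intro p hp hp'
      obtain ⟨α, rfl⟩ := Submodule.mem_span_singleton.1 hp
      obtain ⟨β, hβ⟩ := Submodule.mem_span_singleton.1 hp'
      have := hind α (-β) (by rw [neg_smul, hβ, add_neg_cancel])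
      rw [this.1, zero_smul]
    · rw [codisjoint_iff, eq_top_iff]
      intro p _
      obtain ⟨α, β, rfl⟩ := hsp p
      exact Submodule.add_mem_sup (Submodule.smul_mem _ _ (Submodule.mem_span_singleton_self v))
        (Submodule.smul_mem _ _ (Submodule.mem_span_singleton_self w))
  · exact fun ω => map_slowSpace (euclOp_bijective _) (hshift ω) hmap'
  · exact fun ω => map_slowSpace (euclOp_bijective _) (hshift ω) hmap
  -- No upper bound on `ε` is assumed. It comes from the existence of cones for at least one word,
  -- hence from having at least one letter.
  · have hsin : 0 < Real.sin ε := by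
      obtain ⟨v, w, -, -, -, -, -, -, hsin, -⟩ := key' fun _ => ⟨0, hk⟩
      exact hsin
    refine ⟨Real.sin ε ^ 2, by positivity, Real.log (1 + Real.sin ε ^ 2),
      Real.log_pos (by nlinarith), fun ω n _ => ?_⟩
    obtain ⟨v, w, hv, hw, -, h1, h2, -, -, hgrow⟩ := key' ω
    rw [norm_comp_subtypeL_span hv _ h1, norm_comp_subtypeL_span hw _ h2, mul_comm _ (n : ℝ),
      Real.exp_nat_mul, Real.exp_log (by positivity), cocycleProd_eq_seqProd]
    have hprod := intProd_add_natCast (fun i => (A i : GL (Fin 2) ℝ)) ω 0 n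
    simp only [zero_add, intProd_zero, mul_one] at hprod
    rw [← hprod]
    exact hgrow n

end Domination

lemma map_seqProd {G H ι : Type*} [Monoid G] [Monoid H] (f : G →* H) (A : ι → G) (x : ℕ → ι)
    (n : ℕ) : f (seqProd A x n) = seqProd (fun i => f (A i)) x n := by
  induction n with
  | zero => exact map_one f
  | succ n ih => rw [seqProd, map_mul, ih, seqProd]

lemma continuous_seqProd {G ι : Type*} [Monoid G] [TopologicalSpace G] [ContinuousMul G]
    (x : ℕ → ι) (n : ℕ) : Continuous fun A : ι → G => seqProd A x n := by
  induction n with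
  | zero => exact continuous_const
  | succ n ih => exact (continuous_apply (x n)).mul ih

/-! ### Generic perturbation of an elliptic product -/

section Perturbation

variable {ι : Type*} [DecidableEq ι]

/-- Generators whose products do not satisfy any relation used below. -/
def probe (v i : ι) : Matrix (Fin 2) (Fin 2) ℝ :=
  if i = v then !![2, 0; 0, 1] else !![1, 1; 1, 1]

/-- The first letter contributes a matrix of rank one with positive entries; the rank cannot
recover, and left multiplication by either probe matrix preserves positivity. -/
lemma seqProd_probe {v : ι} {x : ℕ → ι} (hv : x 0 ≠ v) (n : ℕ) :
    (∀ i j, 0 < seqProd (probe v) x (n + 1) i j) ∧ (seqProd (probe v) x (n + 1)).det = 0 := by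
  induction n with
  | zero =>
    simp only [seqProd, mul_one, probe, hv, if_false]
    refine ⟨fun i j => ?_, by simp⟩
    fin_cases i <;> fin_cases j <;> simp
  | succ n ih =>
    rw [seqProd]
    refine ⟨fun i j => ?_, by rw [Matrix.det_mul, ih.2, mul_zero]⟩
    have h0 := ih.1 0 j
    have h1 := ih.1 1 j
    rw [Matrix.mul_apply, Fin.sum_univ_two, probe]
    split_ifs
    · fin_cases i <;> simp <;> assumption
    · fin_cases i <;> simp <;> positivity

/-- The segment from the generators `A` to the generators `probe v`. -/
def segmentTo (A : ι → Matrix (Fin 2) (Fin 2) ℝ) (v : ι) (s : ℝ) (i : ι) :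
    Matrix (Fin 2) (Fin 2) ℝ := (1 - s) • A i + s • probe v i

open Polynomial in
/-- The segment from `A` to `probe v`, with a formal parameter. -/
noncomputable def segmentPoly (A : ι → Matrix (Fin 2) (Fin 2) ℝ) (v i : ι) :
    Matrix (Fin 2) (Fin 2) ℝ[X] := fun j l => (1 - X) * C (A i j l) + X * C (probe v i j l)

open Polynomial in
lemma map_segmentPoly (A : ι → Matrix (Fin 2) (Fin 2) ℝ) (v : ι) (s : ℝ) (x : ℕ → ι) (n : ℕ) :
    (evalRingHom s).mapMatrix (seqProd (segmentPoly A v) x n) =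
      seqProd (segmentTo A v s) x n := by
  have := map_seqProd ((evalRingHom s).mapMatrix (m := Fin 2)).toMonoidHom
    (segmentPoly A v) x n
  refine this.trans ?_
  congr 1
  ext i j l
  simp [segmentPoly, segmentTo]
  exact mul_comm _ _

lemma segmentTo_one (A : ι → Matrix (Fin 2) (Fin 2) ℝ) (v : ι) : segmentTo A v 1 = probe v := by
  ext i j l
  simp [segmentTo]

lemma segmentTo_zero (A : ι → Matrix (Fin 2) (Fin 2) ℝ) (v : ι) : segmentTo A v 0 = A := by
  ext i j l
  simp [segmentTo]

lemma continuous_segmentTo (A : ι → Matrix (Fin 2) (Fin 2) ℝ) (v : ι) :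
    Continuous (segmentTo A v) := by
  refine continuous_pi fun i => ?_
  unfold segmentTo
  fun_prop

open Polynomial in
-- For each `c` the relation is a polynomial equation in `s`. It fails at `s = 1`, where the
-- determinant is zero and the trace positive, so it has finitely many roots.
lemma countable_setOf_trace_sq_mem (A : ι → Matrix (Fin 2) (Fin 2) ℝ) {v : ι} {x : ℕ → ι}
    (hv : x 0 ≠ v) {n : ℕ} (hn : n ≠ 0) {S : Set ℝ} (hS : S.Countable) :
    {s : ℝ | ∃ c ∈ S, (seqProd (segmentTo A v s) x n).trace ^ 2 =
      c * (seqProd (segmentTo A v s) x n).det}.Countable := by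
  obtain ⟨n, rfl⟩ := Nat.exists_eq_succ_of_ne_zero hn
  have : {s : ℝ | ∃ c ∈ S, (seqProd (segmentTo A v s) x (n + 1)).trace ^ 2 =
      c * (seqProd (segmentTo A v s) x (n + 1)).det} =
      ⋃ c ∈ S, {s | (seqProd (segmentTo A v s) x (n + 1)).trace ^ 2 =
      c * (seqProd (segmentTo A v s) x (n + 1)).det} := by
    ext s; simp
  rw [Nat.succ_eq_add_one, this]
  refine hS.biUnion fun c _ => Set.Finite.countable ?_
  set P := seqProd (segmentPoly A v) x (n + 1) with hP
  set f : ℝ[X] := P.trace ^ 2 - C c * P.det with hf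
  have heval : ∀ s, f.eval s = (seqProd (segmentTo A v s) x (n + 1)).trace ^ 2 -
      c * (seqProd (segmentTo A v s) x (n + 1)).det := by
    intro s
    rw [← map_segmentPoly, ← RingHom.map_det, hf, ← coe_evalRingHom, map_sub, map_pow, map_mul,
      Matrix.trace_fin_two, Matrix.trace_fin_two, map_add]
    simp [P]
  have hf0 : f ≠ 0 := by
    intro h0
    have h1 := heval 1
    rw [h0, segmentTo_one, (seqProd_probe hv n).2, eval_zero, Matrix.trace_fin_two] at h1
    have h2 := (seqProd_probe hv n).1 0 0
    have h3 := (seqProd_probe hv n).1 1 1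
    nlinarith
  refine (finite_setOfPred_isRoot hf0).subset fun s hs => ?_
  change f.eval s = 0
  rw [heval, sub_eq_zero]
  exact hs

open Polynomial in
-- One entry of the commutator is a polynomial in `s`. At `s = 1` the commutator with `diag(2, 1)`
-- has there the positive off-diagonal entry of the product.
lemma finite_setOf_commute (A : ι → Matrix (Fin 2) (Fin 2) ℝ) {v : ι} {x : ℕ → ι}
    (hv : x 0 ≠ v) {n : ℕ} (hn : n ≠ 0) :
    {s : ℝ | segmentTo A v s v * seqProd (segmentTo A v s) x n =
      seqProd (segmentTo A v s) x n * segmentTo A v s v}.Finite := by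
  obtain ⟨n, rfl⟩ := Nat.exists_eq_succ_of_ne_zero hn
  set P := seqProd (segmentPoly A v) x (n + 1) with hP
  set f : ℝ[X] := (segmentPoly A v v * P - P * segmentPoly A v v) 0 1 with hf
  have heval : ∀ s, f.eval s = (segmentTo A v s v * seqProd (segmentTo A v s) x (n + 1) -
      seqProd (segmentTo A v s) x (n + 1) * segmentTo A v s v) 0 1 := by
    intro s
    have h1 : (evalRingHom s).mapMatrix (segmentPoly A v v) = segmentTo A v s v := by
      have := map_segmentPoly A v s (fun _ => v) 1
      simpa [seqProd] using this
    rw [← map_segmentPoly, ← h1, ← map_mul, ← map_mul, ← map_sub]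
    rfl
  have hf0 : f ≠ 0 := by
    intro h0
    have h1 := heval 1
    have h2 := (seqProd_probe hv n).1 0 1
    rw [h0, segmentTo_one, eval_zero] at h1
    generalize seqProd (probe v) x (n + 1) = W at h1 h2
    rw [show probe v v = !![2, 0; 0, 1] from if_pos rfl, Matrix.sub_apply, Matrix.mul_apply,
      Matrix.mul_apply, Fin.sum_univ_two, Fin.sum_univ_two] at h1
    simp at h1
    linarith
  refine (finite_setOfPred_isRoot hf0).subset fun s hs => ?_
  change f.eval s = 0
  rw [heval, sub_eq_zero.2 hs]
  rfl

/-- The bad parameters on the segment are countable, hence avoidable near `0`; ellipticity and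
positivity of the determinants are open and survive there. -/
lemma exists_generic_near (A : ι → Matrix (Fin 2) (Fin 2) ℝ) (hA : ∀ i, 0 < (A i).det) [Finite ι]
    {v : ι} {x : ℕ → ι} (hv : x 0 ≠ v) {n : ℕ}
    (hell : (seqProd A x n).trace ^ 2 < 4 * (seqProd A x n).det) {S : Set ℝ} (hS : S.Countable)
    {U : Set (ι → Matrix (Fin 2) (Fin 2) ℝ)} (hU : U ∈ nhds A) :
    ∃ B ∈ U, (∀ i, 0 < (B i).det) ∧ (seqProd B x n).trace ^ 2 < 4 * (seqProd B x n).det ∧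
      (∀ c ∈ S, (seqProd B x n).trace ^ 2 ≠ c * (seqProd B x n).det) ∧
      B v * seqProd B x n ≠ seqProd B x n * B v := by
  have hn : n ≠ 0 := by
    rintro rfl
    simp [seqProd] at hell
    norm_num at hell
  have hdense := ((countable_setOf_trace_sq_mem A hv hn hS).union
    (finite_setOf_commute A hv hn).countable).dense_compl ℝ
  have hdet : Continuous fun s => (seqProd (segmentTo A v s) x n).det :=
    ((continuous_seqProd x n).comp (continuous_segmentTo A v)).matrix_det
  have htr : Continuous fun s => (seqProd (segmentTo A v s) x n).trace :=
    ((continuous_seqProd x n).comp (continuous_segmentTo A v)).matrix_trace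
  have h1 : ∀ᶠ s in nhds (0 : ℝ), segmentTo A v s ∈ U :=
    (continuous_segmentTo A v).continuousAt.eventually_mem (by rwa [segmentTo_zero])
  have h2 : ∀ᶠ s in nhds (0 : ℝ), ∀ i, 0 < (segmentTo A v s i).det := by
    rw [Filter.eventually_all]
    intro i
    have : Continuous fun s => (segmentTo A v s i).det :=
      ((continuous_apply i).comp (continuous_segmentTo A v)).matrix_det
    exact continuousAt_const.eventually_lt this.continuousAt (by rw [segmentTo_zero]; exact hA i)
  have h3 : ∀ᶠ s in nhds (0 : ℝ), (seqProd (segmentTo A v s) x n).trace ^ 2 <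
      4 * (seqProd (segmentTo A v s) x n).det :=
    (show Continuous fun s => (seqProd (segmentTo A v s) x n).trace ^ 2 from
      htr.pow 2).continuousAt.eventually_lt (continuous_const.mul hdet).continuousAt
      (by rwa [segmentTo_zero])
  obtain ⟨s, ⟨hs1, hs2, hs3⟩, hs⟩ :=
    hdense.inter_nhds_nonempty (Filter.inter_mem h1 (Filter.inter_mem h2 h3)) |>.imp
      fun s h => (⟨h.2, h.1⟩ : _ ∧ _)
  refine ⟨_, hs1, hs2, hs3, fun c hc h => hs (Or.inl ⟨c, hc, h⟩), fun h => hs (Or.inr h)⟩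

end Perturbation

/-! ### The action on the disk and the covering property -/

/-- The matrix of the multiplication by `z`. -/
def confMat (z : ℂ) : Matrix (Fin 2) (Fin 2) ℝ := !![z.re, -z.im; z.im, z.re]

lemma confMat_mul (z w : ℂ) : confMat (z * w) = confMat z * confMat w := by
  ext i j
  fin_cases i <;> fin_cases j <;> simp [confMat, Matrix.mul_apply, Fin.sum_univ_two] <;> ring

lemma confMat_pow (z : ℂ) (n : ℕ) : confMat (z ^ n) = confMat z ^ n := by
  induction n with
  | zero =>
    rw [pow_zero, pow_zero]
    ext i j
    fin_cases i <;> fin_cases j <;> simp [confMat]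
  | succ n ih => rw [pow_succ, pow_succ, confMat_mul, ih]

lemma linPart_confMat (z : ℂ) : linPart (confMat z) = z := by
  apply Complex.ext <;> simp [linPart, confMat]

lemma antiPart_confMat (z : ℂ) : antiPart (confMat z) = 0 := by
  apply Complex.ext <;> simp [antiPart, confMat]

lemma eq_confMat_of_antiPart_eq_zero {M : Matrix (Fin 2) (Fin 2) ℝ} (h : antiPart M = 0) :
    M = confMat (linPart M) := by
  have h0 := congrArg Complex.re h
  have h1 := congrArg Complex.im h
  simp [antiPart] at h0 h1
  ext i j
  fin_cases i <;> fin_cases j <;> simp [confMat, linPart] <;> linarith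

lemma exists_conj_confMat {M : Matrix (Fin 2) (Fin 2) ℝ} (h : M.trace ^ 2 < 4 * M.det) :
    ∃ (H : Matrix (Fin 2) (Fin 2) ℝ) (z : ℂ), 0 < H.det ∧ M * H = H * confMat z ∧
      z.re = M.trace / 2 ∧ Complex.normSq z = M.det := by
  rw [Matrix.trace_fin_two, Matrix.det_fin_two] at *
  set a := M 0 0 with ha
  set b := M 0 1 with hb
  set c := M 1 0 with hc
  set d := M 1 1 with hd
  have hc0 : c ≠ 0 := by
    rintro h0
    rw [h0] at h
    nlinarith [sq_nonneg (a - d)]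
  have hΔ : 0 < (a * d - b * c) - (a + d) ^ 2 / 4 := by linarith
  -- The imaginary part of the eigenvalue takes the sign of `c`, so that the conjugating matrix, of
  -- determinant `c / y`, preserves orientation.
  obtain ⟨y, hy, hyc⟩ : ∃ y : ℝ, y ^ 2 = (a * d - b * c) - (a + d) ^ 2 / 4 ∧ 0 < c / y := by
    rcases lt_or_gt_of_ne hc0 with h0 | h0
    · exact ⟨-√_, by rw [neg_sq, Real.sq_sqrt hΔ.le],
        div_pos_of_neg_of_neg h0 (neg_lt_zero.2 (Real.sqrt_pos.2 hΔ))⟩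
    · exact ⟨√_, Real.sq_sqrt hΔ.le, div_pos h0 (Real.sqrt_pos.2 hΔ)⟩
  have hy0 : y ≠ 0 := by
    rintro rfl
    simp at hyc
  refine ⟨!![1, (a - d) / 2 / y; 0, c / y], ⟨(a + d) / 2, y⟩, by simpa using hyc, ?_, rfl, ?_⟩
  · ext i j
    fin_cases i <;> fin_cases j <;>
      simp [confMat, Matrix.mul_apply, Fin.sum_univ_two, ← ha, ← hb, ← hc, ← hd] <;> field_simp
    · ring
    · linear_combination 4 * hy
    · ring
  · rw [Complex.normSq_mk]
    linear_combination hy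

/-- The Möbius map of the disk induced by `M` sends `w` into the open disk of radius `ρ`. -/
def MapsIntoDisk (ρ : ℝ) (M : Matrix (Fin 2) (Fin 2) ℝ) (w : ℂ) : Prop :=
  ‖linPart M * w + antiPart M‖ < ρ * ‖star (antiPart M) * w + star (linPart M)‖

/-- After a change of basis, every point of some closed disk is sent into the interior of the disk
by two different words of the same length. -/
def DiskCovering {ι : Type*} (A : ι → Matrix (Fin 2) (Fin 2) ℝ) : Prop :=
  ∃ H : Matrix (Fin 2) (Fin 2) ℝ, 0 < H.det ∧ ∃ ρ : ℝ, 0 < ρ ∧ ρ < 1 ∧ ∃ l : ℕ,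
    ∀ w : ℂ, ‖w‖ ≤ ρ → ∃ p q : ℕ → ι, (∃ j < l, p j ≠ q j) ∧
      MapsIntoDisk ρ (H⁻¹ * seqProd A p l * H) w ∧ MapsIntoDisk ρ (H⁻¹ * seqProd A q l * H) w

lemma continuous_linPart : Continuous linPart := by
  have : linPart = fun M => (((M 0 0 + M 1 1) / 2 : ℝ) : ℂ) +
      (((M 1 0 - M 0 1) / 2 : ℝ) : ℂ) * Complex.I := by
    ext M
    apply Complex.ext <;> simp [linPart]
  rw [this]
  fun_prop

lemma continuous_antiPart : Continuous antiPart := by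
  have : antiPart = fun M => (((M 0 0 - M 1 1) / 2 : ℝ) : ℂ) +
      (((M 1 0 + M 0 1) / 2 : ℝ) : ℂ) * Complex.I := by
    ext M
    apply Complex.ext <;> simp [antiPart]
  rw [this]
  fun_prop

lemma isOpen_mapsIntoDisk (ρ : ℝ) :
    IsOpen {p : Matrix (Fin 2) (Fin 2) ℝ × ℂ | MapsIntoDisk ρ p.1 p.2} := by
  have h1 := continuous_linPart.comp (continuous_fst (X := Matrix (Fin 2) (Fin 2) ℝ) (Y := ℂ))
  have h2 := continuous_antiPart.comp (continuous_fst (X := Matrix (Fin 2) (Fin 2) ℝ) (Y := ℂ))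
  exact isOpen_lt ((h1.mul continuous_snd).add h2).norm
    (continuous_const.mul ((h2.star.mul continuous_snd).add h1.star).norm)

/-- The conjugation, radius and length are kept; the two words at each point are given by strict
inequalities, and the closed disk is compact. -/
lemma isOpen_diskCovering (ι : Type*) :
    IsOpen {A : ι → Matrix (Fin 2) (Fin 2) ℝ | DiskCovering A} := by
  rw [isOpen_iff_mem_nhds]
  rintro A ⟨H, hH, ρ, h0, h1, l, h⟩
  have key : ∀ᶠ B in nhds A, ∀ w ∈ Metric.closedBall (0 : ℂ) ρ, ∃ p q : ℕ → ι,
      (∃ j < l, p j ≠ q j) ∧ MapsIntoDisk ρ (H⁻¹ * seqProd B p l * H) w ∧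
        MapsIntoDisk ρ (H⁻¹ * seqProd B q l * H) w := by
    refine (isCompact_closedBall (0 : ℂ) ρ).eventually_forall_of_forall_eventually fun w hw => ?_
    obtain ⟨p, q, hpq, hp, hq⟩ := h w (by simpa using hw)
    have hopen : ∀ p : ℕ → ι, IsOpen {z : (ι → Matrix (Fin 2) (Fin 2) ℝ) × ℂ |
        MapsIntoDisk ρ (H⁻¹ * seqProd z.1 p l * H) z.2} := fun p => by
      refine (isOpen_mapsIntoDisk ρ).preimage
        (f := fun z : (ι → Matrix (Fin 2) (Fin 2) ℝ) × ℂ => (H⁻¹ * seqProd z.1 p l * H, z.2)) ?_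
      have := (continuous_seqProd (G := Matrix (Fin 2) (Fin 2) ℝ) p l).comp
        (continuous_fst (X := ι → Matrix (Fin 2) (Fin 2) ℝ) (Y := ℂ))
      exact ((continuous_const.mul this).mul continuous_const).prodMk continuous_snd
    filter_upwards [(hopen p).mem_nhds hp, (hopen q).mem_nhds hq] with z hz hz'
    exact ⟨p, q, hpq, hz, hz'⟩
  filter_upwards [key] with B hB
  exact ⟨H, hH, ρ, h0, h1, l, fun w hw => hB w (by simpa using hw)⟩

/-- Rotate `w` onto the ray through `-b/a`, the point that `M` sends to the center. There the image
has modulus `||b| - r|a|| / (|a| - |b|r)` with `r = |w|`, which is less than `ρ` because `|b|/|a| <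
ρ < 1` and `r ≤ ρ`. -/
lemma exists_rotation_mapsIntoDisk {M : Matrix (Fin 2) (Fin 2) ℝ} (ha : linPart M ≠ 0)
    (hb : antiPart M ≠ 0) {ρ : ℝ} (hρ : ‖antiPart M‖ < ρ * ‖linPart M‖) (hρ1 : ρ < 1) {w : ℂ}
    (hw : ‖w‖ ≤ ρ) : ∃ u : Circle, MapsIntoDisk ρ M (u * w) := by
  set a := linPart M with hadef
  set b := antiPart M with hbdef
  have ha' : 0 < ‖a‖ := norm_pos_iff.2 ha
  have hb' : 0 < ‖b‖ := norm_pos_iff.2 hb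
  obtain ⟨u, hu⟩ : ∃ u : Circle, (u : ℂ) * w = -(b / a) * ((‖w‖ * (‖a‖ / ‖b‖) : ℝ) : ℂ) := by
    rcases eq_or_ne w 0 with rfl | hw0
    · exact ⟨1, by simp⟩
    · have hw' : 0 < ‖w‖ := norm_pos_iff.2 hw0
      refine ⟨⟨-(b / a) * ((‖w‖ * (‖a‖ / ‖b‖) : ℝ) : ℂ) / w, ?_⟩, ?_⟩
      · rw [Submonoid.unitSphere, ← SetLike.mem_coe]
        change _ ∈ Metric.sphere (0 : ℂ) 1
        rw [mem_sphere_zero_iff_norm, norm_div, norm_mul, norm_neg, norm_div, Complex.norm_real,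
          Real.norm_eq_abs, abs_of_pos (by positivity)]
        field_simp
      · simp only
        rw [div_mul_cancel₀ _ hw0]
  refine ⟨u, ?_⟩
  rw [MapsIntoDisk, hu, ← hadef, ← hbdef]
  set r := ‖w‖ with hr
  have e1 : a * (-(b / a) * ((r * (‖a‖ / ‖b‖) : ℝ) : ℂ)) + b =
      b * ((1 - r * (‖a‖ / ‖b‖) : ℝ) : ℂ) := by
    push_cast
    field_simp
    ring
  have hbb : star b * b = ((‖b‖ ^ 2 : ℝ) : ℂ) := by
    have := Complex.conj_mul' b
    push_cast
    exact this
  have haa : star a * a = ((‖a‖ ^ 2 : ℝ) : ℂ) := by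
    have := Complex.conj_mul' a
    push_cast
    exact this
  have e2 : star b * (-(b / a) * ((r * (‖a‖ / ‖b‖) : ℝ) : ℂ)) + star a =
      ((‖a‖ ^ 2 - ‖b‖ * ‖a‖ * r : ℝ) : ℂ) / a := by
    have hbC : (‖b‖ : ℂ) ≠ 0 := by exact_mod_cast hb'.ne'
    push_cast at hbb haa ⊢
    rw [eq_div_iff ha, add_mul, haa]
    calc star b * (-(b / a) * (r * (‖a‖ / ‖b‖))) * a + (‖a‖ : ℂ) ^ 2
        = -(star b * b) * (r * (‖a‖ / ‖b‖)) + (‖a‖ : ℂ) ^ 2 := by field_simp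
      _ = _ := by
          rw [hbb]
          field_simp
          ring
  have hr0 : 0 ≤ r := norm_nonneg _
  have hρ0 : 0 < ρ := by
    by_contra! h
    nlinarith
  have hba : ‖b‖ < ‖a‖ := by nlinarith
  have hpos : 0 < ‖a‖ ^ 2 - ‖b‖ * ‖a‖ * r := by
    have : ‖b‖ * r < ‖a‖ := by nlinarith
    nlinarith
  rw [e1, e2, norm_mul, norm_div, Complex.norm_real, Complex.norm_real, Real.norm_eq_abs,
    Real.norm_eq_abs, abs_of_pos hpos]
  have e3 : ‖b‖ * |1 - r * (‖a‖ / ‖b‖)| = |‖b‖ - r * ‖a‖| := by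
    nth_rw 1 [← abs_of_pos hb']
    rw [← abs_mul]
    congr 1
    field_simp
  have e4 : ρ * ((‖a‖ ^ 2 - ‖b‖ * ‖a‖ * r) / ‖a‖) = ρ * (‖a‖ - ‖b‖ * r) := by
    field_simp
  rw [e3, e4, abs_lt]
  constructor
  · have h1 : r * ‖a‖ ≤ ρ * ‖a‖ := mul_le_mul_of_nonneg_right hw ha'.le
    have h2 : ρ * r * ‖b‖ < 1 * ‖b‖ := mul_lt_mul_of_pos_right (by nlinarith) hb'
    nlinarith
  · have h1 : r * (ρ * ‖b‖) ≤ r * ‖a‖ := mul_le_mul_of_nonneg_left (by nlinarith) hr0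
    nlinarith

/-- The good rotations at each point form a nonempty open set, which a dense sequence of powers
hits; compactness of the disk bounds the exponents. -/
lemma exists_pow_mapsIntoDisk {M : Matrix (Fin 2) (Fin 2) ℝ} (ha : linPart M ≠ 0)
    (hb : antiPart M ≠ 0) {ρ : ℝ} (hρ : ‖antiPart M‖ < ρ * ‖linPart M‖) (hρ1 : ρ < 1) {u : Circle}
    (hu : DenseRange fun n : ℕ => u ^ n) :
    ∃ N, ∀ w : ℂ, ‖w‖ ≤ ρ → ∃ m ≤ N, MapsIntoDisk ρ M ((u : ℂ) ^ m * w) := by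
  have hopen : IsOpen {w : ℂ | MapsIntoDisk ρ M w} :=
    (isOpen_mapsIntoDisk ρ).preimage (f := fun w => (M, w)) (by fun_prop)
  obtain ⟨t, ht⟩ := (isCompact_closedBall (0 : ℂ) ρ).elim_finite_subcover
    (fun m : ℕ => {w : ℂ | MapsIntoDisk ρ M ((u : ℂ) ^ m * w)})
    (fun m => hopen.preimage (f := fun w => (u : ℂ) ^ m * w) (by fun_prop)) (by
      intro w hw
      obtain ⟨ζ, hζ⟩ := exists_rotation_mapsIntoDisk ha hb hρ hρ1 (w := w) (by simpa using hw)
      have hopen' : IsOpen {ζ : Circle | MapsIntoDisk ρ M (ζ * w)} :=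
        hopen.preimage (f := fun ζ : Circle => (ζ : ℂ) * w)
          (continuous_subtype_val.mul continuous_const)
      obtain ⟨m, hm⟩ := hu.exists_mem_open hopen' ⟨ζ, hζ⟩
      rw [Set.mem_iUnion]
      refine ⟨m, ?_⟩
      simpa using hm)
  refine ⟨t.sup id, fun w hw => ?_⟩
  have := ht (show w ∈ Metric.closedBall (0 : ℂ) ρ by simpa using hw)
  simp only [Set.mem_iUnion] at this
  obtain ⟨m, hm, h⟩ := this
  exact ⟨m, Finset.le_sup (f := id) hm, h⟩

lemma denseRange_pow_of_forall_ne_one {u : Circle} (h : ∀ n : ℕ, 0 < n → u ^ n ≠ 1) :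
    DenseRange fun n : ℕ => u ^ n := by
  rw [← denseRange_zpow_iff_pow]
  have : Fact ((0 : ℝ) < 1) := ⟨one_pos⟩
  obtain ⟨t, rfl⟩ : ∃ t : AddCircle (1 : ℝ), AddCircle.toCircle t = u := by
    obtain ⟨t, ht⟩ := (AddCircle.homeomorphCircle (one_ne_zero (α := ℝ))).surjective u
    exact ⟨t, by rw [← ht, AddCircle.homeomorphCircle_apply]⟩
  have ht : addOrderOf t = 0 := by
    rw [addOrderOf_eq_zero_iff']
    intro n hn h0
    apply h n hn
    rw [← AddCircle.toCircle_nsmul, h0, AddCircle.toCircle_zero]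
  have hd := AddCircle.denseRange_zsmul_iff.2 ht
  have hs : Function.Surjective (AddCircle.toCircle (T := 1)) := fun u => by
    obtain ⟨t, ht⟩ := (AddCircle.homeomorphCircle (one_ne_zero (α := ℝ))).surjective u
    exact ⟨t, by rw [← ht, AddCircle.homeomorphCircle_apply]⟩
  have := hs.denseRange.comp hd AddCircle.continuous_toCircle
  simpa only [Function.comp_def, AddCircle.toCircle_zsmul] using this

section Words

variable {G ι : Type*} [Monoid G]

lemma seqProd_congr (A : ι → G) {x y : ℕ → ι} {n : ℕ} (h : ∀ j < n, x j = y j) :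
    seqProd A x n = seqProd A y n := by
  induction n with
  | zero => rfl
  | succ n ih => rw [seqProd, seqProd, ih fun j hj => h j (by omega), h n (by omega)]

lemma seqProd_add (A : ι → G) (x : ℕ → ι) (n m : ℕ) :
    seqProd A x (n + m) = seqProd A (fun j => x (n + j)) m * seqProd A x n := by
  induction m with
  | zero => simp [seqProd]
  | succ m ih => rw [← add_assoc, seqProd, ih, seqProd, mul_assoc]

lemma exists_seqProd_mul (A : ι → G) (p q : ℕ → ι) (n m : ℕ) :
    ∃ r, seqProd A r (n + m) = seqProd A q m * seqProd A p n := by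
  refine ⟨fun j => if j < n then p j else q (j - n), ?_⟩
  rw [seqProd_add]
  congr 1
  · exact seqProd_congr A fun j _ => by simp
  · exact seqProd_congr A fun j hj => by simp [hj]

lemma exists_seqProd_pow (A : ι → G) (p : ℕ → ι) (n m : ℕ) :
    ∃ r, seqProd A r (n * m) = seqProd A p n ^ m := by
  induction m with
  | zero => exact ⟨p, by simp [seqProd]⟩
  | succ m ih =>
    obtain ⟨r, hr⟩ := ih
    obtain ⟨r', hr'⟩ := exists_seqProd_mul A r p (n * m) n
    exact ⟨r', by rw [mul_add, mul_one, hr', hr, pow_succ']⟩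

end Words

lemma linPart_confMat_mul (y : ℂ) (M : Matrix (Fin 2) (Fin 2) ℝ) (z : ℂ) :
    linPart (confMat y * M * confMat z) = y * linPart M * z := by
  simp [linPart_mul, antiPart_mul, linPart_confMat, antiPart_confMat]

lemma antiPart_confMat_mul (y : ℂ) (M : Matrix (Fin 2) (Fin 2) ℝ) (z : ℂ) :
    antiPart (confMat y * M * confMat z) = y * antiPart M * star z := by
  simp [linPart_mul, antiPart_mul, linPart_confMat, antiPart_confMat]

/-- A conformal matrix acts on the disk as the rotation by `z / z̄`; on the left it does not affect
the modulus of the image. -/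
lemma mapsIntoDisk_confMat_mul {ρ : ℝ} {y z : ℂ} (hy : y ≠ 0) (hz : z ≠ 0)
    {M : Matrix (Fin 2) (Fin 2) ℝ} {w : ℂ} (h : MapsIntoDisk ρ M (z / star z * w)) :
    MapsIntoDisk ρ (confMat y * M * confMat z) w := by
  have hz' : star z ≠ 0 := star_ne_zero.2 hz
  rw [MapsIntoDisk] at h ⊢
  rw [linPart_confMat_mul, antiPart_confMat_mul]
  have e1 : y * linPart M * z * w + y * antiPart M * star z =
      y * star z * (linPart M * (z / star z * w) + antiPart M) := by
    field_simp
  have e2 : star (y * antiPart M * star z) * w + star (y * linPart M * z) =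
      star y * star z * (star (antiPart M) * (z / star z * w) + star (linPart M)) := by
    simp only [star_mul', star_star]
    field_simp
  rw [e1, e2, norm_mul, norm_mul (star y * star z), norm_mul, norm_mul, norm_star, norm_star,
    mul_left_comm ρ]
  have : 0 < ‖y‖ * ‖z‖ := mul_pos (norm_pos_iff.2 hy) (norm_pos_iff.2 hz)
  exact mul_lt_mul_of_pos_left h this

/-- The values of `tr² / det` of the matrices that are conjugate to rotations of finite order. -/
def finiteOrderValues : Set ℝ :=
  (fun z : ℂ => 2 * (z.re + 1)) '' {z | ∃ n : ℕ, 0 < n ∧ z ^ n = 1}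

lemma countable_finiteOrderValues : finiteOrderValues.Countable := by
  apply Set.Countable.image
  have : {z : ℂ | ∃ n : ℕ, 0 < n ∧ z ^ n = 1} ⊆
      ⋃ n : ℕ, ((Polynomial.nthRoots n (1 : ℂ)).toFinset : Set ℂ) := by
    rintro z ⟨n, hn, hz⟩
    rw [Set.mem_iUnion]
    exact ⟨n, by simpa [Polynomial.mem_nthRoots hn] using hz⟩
  exact (Set.countable_iUnion fun n => Finset.countable_toSet _).mono this

/-- The words are `W ^ (2N + 1 - m) * B v * W ^ m`. The right power rotates the point to where `B v`
sends it into the disk; the left power is a harmless rotation that makes the length independent of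
`m`. -/
lemma diskCovering_of_elliptic {ι : Type*} {B : ι → Matrix (Fin 2) (Fin 2) ℝ}
    (hB : ∀ i, 0 < (B i).det) {v : ι} {x : ℕ → ι} {n : ℕ}
    (hell : (seqProd B x n).trace ^ 2 < 4 * (seqProd B x n).det)
    (hirr : ∀ c ∈ finiteOrderValues, (seqProd B x n).trace ^ 2 ≠ c * (seqProd B x n).det)
    (hcomm : B v * seqProd B x n ≠ seqProd B x n * B v) : DiskCovering B := by
  obtain ⟨H, z, hH, hconj, hre, hnorm⟩ := exists_conj_confMat hell
  set W := seqProd B x n with hW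
  have hWdet : 0 < W.det := det_seqProd_pos hB x n
  have hz : z ≠ 0 := by
    rintro rfl
    rw [Complex.normSq_zero] at hnorm
    linarith
  have hz' : star z ≠ 0 := star_ne_zero.2 hz
  have hHu : IsUnit H.det := hH.ne'.isUnit
  set u : Circle := ⟨z / star z, by
    rw [Submonoid.unitSphere, ← SetLike.mem_coe]
    change _ ∈ Metric.sphere (0 : ℂ) 1
    rw [mem_sphere_zero_iff_norm, norm_div, norm_star, div_self (norm_ne_zero_iff.2 hz)]⟩ with hu
  have hu_coe : (u : ℂ) = z / star z := rfl
  have hord : ∀ m : ℕ, 0 < m → u ^ m ≠ 1 := by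
    intro m hm h
    have h1 : ((u : ℂ)) ^ m = 1 := by
      rw [← Circle.coe_pow, h, Circle.coe_one]
    refine hirr _ ⟨u, ⟨m, hm, h1⟩, rfl⟩ ?_
    -- This is `Re (z²) = 2 (Re z)² - |z|²`. It turns the rotation `u` into the invariant `tr² / det
    -- = 2 (Re u + 1)` that is excluded for finite order.
    have h2 : (u : ℂ).re * Complex.normSq z = 2 * z.re ^ 2 - Complex.normSq z := by
      have h3 : (u : ℂ) = z * z / (Complex.normSq z : ℂ) := by
        rw [hu_coe, Complex.normSq_eq_conj_mul_self]
        change _ = z * z / (star z * z)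
        field_simp
      have h4 : Complex.normSq z ≠ 0 := by rwa [Ne, Complex.normSq_eq_zero]
      rw [h3, Complex.div_ofReal_re, div_mul_cancel₀ _ h4, Complex.mul_re, Complex.normSq_apply]
      ring
    simp only
    rw [← hnorm]
    rw [hre] at h2
    linear_combination (-2) * h2
  set D := H⁻¹ * B v * H with hD
  have hDdet : 0 < D.det := by
    rw [hD, Matrix.det_mul, Matrix.det_mul, mul_right_comm, ← Matrix.det_mul,
      Matrix.nonsing_inv_mul _ hHu, Matrix.det_one, one_mul]
    exact hB v
  have hBD : B v = H * D * H⁻¹ := by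
    rw [hD]
    simp only [mul_assoc]
    rw [Matrix.mul_nonsing_inv _ hHu, mul_one, Matrix.mul_nonsing_inv_cancel_left _ _ hHu]
  have hWC : W = H * confMat z * H⁻¹ := by
    rw [← hconj, mul_assoc, Matrix.mul_nonsing_inv _ hHu, mul_one]
  -- Otherwise `B v` and `W` would be simultaneously conjugate to conformal matrices, which commute.
  have hb : antiPart D ≠ 0 := by
    intro h0
    apply hcomm
    rw [hBD, hWC, eq_confMat_of_antiPart_eq_zero h0]
    have e : ∀ X Y : Matrix (Fin 2) (Fin 2) ℝ, H * X * H⁻¹ * (H * Y * H⁻¹) = H * (X * Y) * H⁻¹ := by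
      intro X Y
      simp only [mul_assoc]
      rw [Matrix.nonsing_inv_mul_cancel_left _ _ hHu]
    rw [e, e, ← confMat_mul, ← confMat_mul, mul_comm]
  have hlt : ‖antiPart D‖ < ‖linPart D‖ := by
    rw [det_eq_normSq_sub, Complex.normSq_eq_norm_sq, Complex.normSq_eq_norm_sq] at hDdet
    exact lt_of_pow_lt_pow_left₀ 2 (norm_nonneg _) (by linarith)
  have ha' : 0 < ‖linPart D‖ := (norm_nonneg _).trans_lt hlt
  have ha : linPart D ≠ 0 := norm_pos_iff.1 ha'
  obtain ⟨ρ, hρ, hρ1⟩ := exists_between ((div_lt_one ha').2 hlt)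
  have hρ0 : 0 < ρ := lt_of_le_of_lt (by positivity) hρ
  rw [div_lt_iff₀ ha'] at hρ
  obtain ⟨N, hN⟩ := exists_pow_mapsIntoDisk ha hb hρ hρ1 (denseRange_pow_of_forall_ne_one hord)
  have hsemi : ∀ m, W ^ m * H = H * confMat z ^ m := fun m =>
    ((show SemiconjBy H (confMat z) W from hconj.symm).pow_right m).symm
  have hword : ∀ m ≤ 2 * N + 1, ∃ p : ℕ → ι,
      H⁻¹ * seqProd B p (n * (2 * N + 1) + 1) * H =
        confMat (z ^ (2 * N + 1 - m)) * D * confMat (z ^ m) := by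
    intro m hm
    obtain ⟨p, hp⟩ := exists_seqProd_pow B x n m
    obtain ⟨q, hq⟩ := exists_seqProd_pow B x n (2 * N + 1 - m)
    obtain ⟨r, hr⟩ := exists_seqProd_mul B p (fun _ => v) (n * m) 1
    obtain ⟨r', hr'⟩ := exists_seqProd_mul B r q (n * m + 1) (n * (2 * N + 1 - m))
    refine ⟨r', ?_⟩
    have hlen : n * (2 * N + 1) + 1 = n * m + 1 + n * (2 * N + 1 - m) := by
      rw [add_right_comm, ← mul_add, Nat.add_sub_cancel' hm]
    have hone : seqProd B (fun _ => v) 1 = B v := by simp [seqProd]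
    rw [hlen, hr', hr, hp, hq, hone, confMat_pow, confMat_pow, ← hW, hBD]
    calc H⁻¹ * (W ^ (2 * N + 1 - m) * (H * D * H⁻¹ * W ^ m)) * H
        = H⁻¹ * (W ^ (2 * N + 1 - m) * H) * D * (H⁻¹ * (W ^ m * H)) := by simp only [mul_assoc]
      _ = _ := by
        rw [hsemi, hsemi, Matrix.nonsing_inv_mul_cancel_left _ _ hHu,
          Matrix.nonsing_inv_mul_cancel_left _ _ hHu]
  refine ⟨H, hH, ρ, hρ0, hρ1, n * (2 * N + 1) + 1, fun w hw => ?_⟩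
  have hmaps : ∀ m ≤ 2 * N + 1, ∀ p : ℕ → ι, H⁻¹ * seqProd B p (n * (2 * N + 1) + 1) * H =
        confMat (z ^ (2 * N + 1 - m)) * D * confMat (z ^ m) →
      MapsIntoDisk ρ D ((u : ℂ) ^ m * w) →
      MapsIntoDisk ρ (H⁻¹ * seqProd B p (n * (2 * N + 1) + 1) * H) w := by
    intro m _ p hp h
    rw [hp]
    apply mapsIntoDisk_confMat_mul (pow_ne_zero _ hz) (pow_ne_zero _ hz)
    rwa [star_pow, ← div_pow, ← hu_coe]
  obtain ⟨m, hm, hm'⟩ := hN w hw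
  -- Starting from the point rotated `N + 1` times gives a second exponent `j + N + 1`, larger than
  -- the first one `m ≤ N`.
  obtain ⟨j, hj, hj'⟩ := hN ((u : ℂ) ^ (N + 1) * w) (by
    rw [norm_mul, norm_pow, Circle.norm_coe, one_pow, one_mul]
    exact hw)
  rw [← mul_assoc, ← pow_add] at hj'
  obtain ⟨p, hp⟩ := hword m (by omega)
  obtain ⟨q, hq⟩ := hword (j + (N + 1)) (by omega)
  refine ⟨p, q, ?_, hmaps m (by omega) p hp hm', hmaps _ (by omega) q hq hj'⟩
  -- Equal words would give equal antilinear parts; these determine `u ^ m`, and `u` has infinite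
  -- order.
  by_contra! hpq
  rw [seqProd_congr B hpq, hq] at hp
  have h1 := congrArg antiPart hp
  have hstar : ∀ i, i ≤ 2 * N + 1 → antiPart (confMat (z ^ (2 * N + 1 - i)) * D * confMat (z ^ i)) *
      (u : ℂ) ^ i = z ^ (2 * N + 1) * antiPart D := by
    intro i hi
    rw [antiPart_confMat_mul, hu_coe, star_pow, div_pow]
    have hzi : star z ^ i ≠ 0 := pow_ne_zero _ hz'
    field_simp
    rw [← pow_add, Nat.sub_add_cancel hi]
  have h2 := hstar m (by omega)
  have h3 := hstar (j + (N + 1)) (by omega)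
  rw [h1, ← h2] at h3
  have h4 : antiPart (confMat (z ^ (2 * N + 1 - m)) * D * confMat (z ^ m)) ≠ 0 := by
    rw [antiPart_confMat_mul]
    exact mul_ne_zero (mul_ne_zero (pow_ne_zero _ hz) hb) (star_ne_zero.2 (pow_ne_zero _ hz))
  have h5 : (u : ℂ) ^ (j + (N + 1)) = (u : ℂ) ^ m := mul_left_cancel₀ h4 h3
  have h6 : u ^ (j + (N + 1)) = u ^ m := by
    apply Circle.ext
    rwa [Circle.coe_pow, Circle.coe_pow]
  refine hord (j + (N + 1) - m) (by omega) ?_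
  rw [pow_sub _ (by omega), h6, mul_inv_cancel]

/-! ### Binary trees of words -/

section Branching

variable {X ι : Type*}

/-- The states visited by a branching construction that follows the choices `c`. -/
def branchState (step : X → (ℕ → ι) → X) (P : X → Bool → ℕ → ι) (g : X) (c : ℕ → Bool) : ℕ → X
  | 0 => g
  | j + 1 => step (branchState step P g c j) (P (branchState step P g c j) (c j))

lemma branchState_congr (step : X → (ℕ → ι) → X) (P : X → Bool → ℕ → ι) (g : X)
    {c c' : ℕ → Bool} {n : ℕ} (h : ∀ j < n, c j = c' j) :
    branchState step P g c n = branchState step P g c' n := by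
  induction n with
  | zero => rfl
  | succ n ih => rw [branchState, branchState, ih fun j hj => h j (by omega), h n (by omega)]

/-- Every good state has two distinct good continuations of length `l`, so a binary sequence selects
a word block by block. Prefixes of the word and of the choices determine each other. -/
lemma exists_branching {step : X → (ℕ → ι) → X} {Good : X → Prop} {l : ℕ}
    (hstep : ∀ g p q, (∀ j < l, p j = q j) → step g p = step g q)
    (hgood : ∀ g, Good g → ∃ p q : ℕ → ι, (∃ j < l, p j ≠ q j) ∧ Good (step g p) ∧ Good (step g q))
    {g₀ : X} (hg₀ : Good g₀) :
    ∃ (x : (ℕ → Bool) → ℕ → ι) (g : (ℕ → Bool) → ℕ → X), (∀ c, g c 0 = g₀) ∧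
      (∀ c j, g c (j + 1) = step (g c j) fun i => x c (l * j + i)) ∧ (∀ c j, Good (g c j)) ∧
      (∀ c c' n, (∀ j < n, c j = c' j) → ∀ i < l * n, x c i = x c' i) ∧
      ∀ c c' n, (∀ i < l * n, x c i = x c' i) → ∀ j < n, c j = c' j := by
  have hl : 0 < l := by
    obtain ⟨p, q, ⟨j, hj, -⟩, -⟩ := hgood _ hg₀
    omega
  have hP : ∀ g, ∃ P : Bool → ℕ → ι, Good g →
      (∃ j < l, P true j ≠ P false j) ∧ ∀ b, Good (step g (P b)) := by
    intro g
    by_cases hg : Good g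
    · obtain ⟨p, q, h, hp, hq⟩ := hgood g hg
      exact ⟨fun b => cond b p q, fun _ => ⟨h, fun b => by cases b <;> assumption⟩⟩
    · obtain ⟨p, -⟩ := hgood _ hg₀
      exact ⟨fun _ => p, fun h => absurd h hg⟩
  choose P hP using hP
  set g := branchState step P g₀ with hg
  set x : (ℕ → Bool) → ℕ → ι := fun c i => P (g c (i / l)) (c (i / l)) (i % l) with hx
  have hblock : ∀ c j, ∀ i < l, x c (l * j + i) = P (g c j) (c j) i := by
    intro c j i hi
    simp only [hx]
    rw [Nat.mul_add_div hl, Nat.div_eq_of_lt hi, add_zero, Nat.mul_add_mod, Nat.mod_eq_of_lt hi]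
  have hGood : ∀ c j, Good (g c j) := by
    intro c j
    induction j with
    | zero => exact hg₀
    | succ j ih => exact (hP _ ih).2 _
  refine ⟨x, g, fun c => rfl, fun c j => ?_, hGood, fun c c' n h i hi => ?_, fun c c' n h j => ?_⟩
  · rw [hstep _ _ _ (hblock c j)]
    rfl
  · have hdiv : i / l < n := Nat.div_lt_of_lt_mul hi
    simp only [hx]
    rw [h _ hdiv, hg, branchState_congr step P g₀ fun j hj => h j (by omega)]
  -- Equal earlier choices lead to the same state, whose two continuations differ at a letter that
  -- reveals the present choice.
  · induction j using Nat.strong_induction_on with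
    | _ j ih =>
    intro hj
    have hstate : g c j = g c' j :=
      branchState_congr step P g₀ fun i hi => ih i hi (by omega)
    obtain ⟨i, hi, hne⟩ := (hP _ (hGood c j)).1
    have h1 := h (l * j + i) (by nlinarith)
    rw [hblock c j i hi, hblock c' j i hi, ← hstate] at h1
    revert h1
    cases c j <;> cases c' j
    · simp
    · exact fun h1 => absurd h1.symm hne
    · exact fun h1 => absurd h1 hne
    · simp

end Branching

/-! ### Eccentricity and bounded products -/

/-- The quotient of the singular values of a matrix with positive determinant. -/
noncomputable def eccentricity (M : Matrix (Fin 2) (Fin 2) ℝ) : ℝ :=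
  (‖linPart M‖ + ‖antiPart M‖) ^ 2 / M.det

lemma eccentricity_nonneg {M : Matrix (Fin 2) (Fin 2) ℝ} (hM : 0 < M.det) : 0 ≤ eccentricity M :=
  div_nonneg (sq_nonneg _) hM.le

/-- The sum of the moduli of the linear and antilinear parts is submultiplicative, because
composition mixes the two parts bilinearly. -/
lemma eccentricity_mul_le {M N : Matrix (Fin 2) (Fin 2) ℝ} (hM : 0 < M.det) (hN : 0 < N.det) :
    eccentricity (M * N) ≤ eccentricity M * eccentricity N := by
  have h : ‖linPart (M * N)‖ + ‖antiPart (M * N)‖ ≤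
      (‖linPart M‖ + ‖antiPart M‖) * (‖linPart N‖ + ‖antiPart N‖) := by
    have h1 : ‖linPart (M * N)‖ ≤ ‖linPart M‖ * ‖linPart N‖ + ‖antiPart M‖ * ‖antiPart N‖ := by
      rw [linPart_mul]
      refine (norm_add_le _ _).trans ?_
      rw [norm_mul, norm_mul, norm_star]
    have h2 : ‖antiPart (M * N)‖ ≤ ‖linPart M‖ * ‖antiPart N‖ + ‖antiPart M‖ * ‖linPart N‖ := by
      rw [antiPart_mul]
      refine (norm_add_le _ _).trans ?_
      rw [norm_mul, norm_mul, norm_star]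
    linarith
  rw [eccentricity, eccentricity, eccentricity, div_mul_div_comm, ← mul_pow, Matrix.det_mul]
  gcongr

lemma eccentricity_inv {M : Matrix (Fin 2) (Fin 2) ℝ} (hM : 0 < M.det) :
    eccentricity M⁻¹ = eccentricity M := by
  have hinv : M⁻¹ = M.det⁻¹ • M.adjugate := by
    rw [Matrix.inv_def, Ring.inverse_eq_inv']
  have h1 : linPart M⁻¹ = (M.det⁻¹ : ℝ) * star (linPart M) := by
    rw [hinv, Matrix.adjugate_fin_two]
    apply Complex.ext <;> simp [linPart] <;> ring
  have h2 : antiPart M⁻¹ = -((M.det⁻¹ : ℝ) * antiPart M) := by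
    rw [hinv, Matrix.adjugate_fin_two]
    apply Complex.ext <;> simp [antiPart] <;> ring
  rw [eccentricity, eccentricity, h1, h2, norm_neg, norm_mul, norm_mul, norm_star,
    Complex.norm_real, Real.norm_eq_abs, abs_of_pos (inv_pos.2 hM), Matrix.det_nonsing_inv,
    Ring.inverse_eq_inv']
  field_simp

/-- With `det = |α|² - |β|²` the eccentricity is `(|α| + |β|) / (|α| - |β|)`. -/
lemma eccentricity_le_of_antiPart_le {M : Matrix (Fin 2) (Fin 2) ℝ} (hM : 0 < M.det) {ρ : ℝ}
    (hρ1 : ρ < 1) (h : ‖antiPart M‖ ≤ ρ * ‖linPart M‖) :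
    eccentricity M ≤ (1 + ρ) / (1 - ρ) := by
  have hd := det_eq_normSq_sub M
  rw [Complex.normSq_eq_norm_sq, Complex.normSq_eq_norm_sq] at hd
  rw [eccentricity, div_le_div_iff₀ hM (by linarith), hd]
  have := norm_nonneg (linPart M)
  have := norm_nonneg (antiPart M)
  nlinarith

lemma norm_euclOp_le (g : GL (Fin 2) ℝ) :
    ‖euclOp g‖ ≤ ‖linPart (g : Matrix (Fin 2) (Fin 2) ℝ)‖ +
      ‖antiPart (g : Matrix (Fin 2) (Fin 2) ℝ)‖ := by
  set M := (g : Matrix (Fin 2) (Fin 2) ℝ) with hM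
  refine ContinuousLinearMap.opNorm_le_bound _ (by positivity) fun v => ?_
  have hnorm : ∀ v : EuclideanSpace ℝ (Fin 2), ‖v‖ = ‖(⟨v 0, v 1⟩ : ℂ)‖ := by
    intro v
    rw [EuclideanSpace.norm_eq, Complex.norm_eq_sqrt_sq_add_sq, Fin.sum_univ_two]
    simp
  have hv : (⟨euclOp g v 0, euclOp g v 1⟩ : ℂ) =
      linPart M * ⟨v 0, v 1⟩ + antiPart M * star (⟨v 0, v 1⟩ : ℂ) := by
    have h : ∀ i, euclOp g v i = M.mulVec v i := fun i => rfl
    rw [h, h]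
    apply Complex.ext <;> simp [linPart, antiPart, Matrix.mulVec, dotProduct, Fin.sum_univ_two] <;>
      ring
  rw [hnorm, hnorm, hv, add_mul]
  refine (norm_add_le _ _).trans ?_
  rw [norm_mul, norm_mul, norm_star]

lemma nonConformality_le {g : GL (Fin 2) ℝ} (hg : 0 < (g : Matrix (Fin 2) (Fin 2) ℝ).det) :
    nonConformality g ≤ eccentricity (g : Matrix (Fin 2) (Fin 2) ℝ) := by
  have hinv : ((g⁻¹ : GL (Fin 2) ℝ) : Matrix (Fin 2) (Fin 2) ℝ) =
      (g : Matrix (Fin 2) (Fin 2) ℝ)⁻¹ := Matrix.coe_units_inv g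
  have h1 := norm_euclOp_le g
  have h2 := norm_euclOp_le g⁻¹
  rw [hinv] at h2
  have h3 : ‖linPart (g : Matrix (Fin 2) (Fin 2) ℝ)⁻¹‖ +
      ‖antiPart (g : Matrix (Fin 2) (Fin 2) ℝ)⁻¹‖ = (‖linPart (g : Matrix (Fin 2) (Fin 2) ℝ)‖ +
      ‖antiPart (g : Matrix (Fin 2) (Fin 2) ℝ)‖) / (g : Matrix (Fin 2) (Fin 2) ℝ).det := by
    set M := (g : Matrix (Fin 2) (Fin 2) ℝ)
    have e := eccentricity_inv hg
    have hdet : (M⁻¹).det = M.det⁻¹ := by rw [Matrix.det_nonsing_inv, Ring.inverse_eq_inv']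
    rw [eccentricity, eccentricity, hdet, div_inv_eq_mul] at e
    have e' : (‖linPart M⁻¹‖ + ‖antiPart M⁻¹‖) ^ 2 =
        ((‖linPart M‖ + ‖antiPart M‖) / M.det) ^ 2 := by
      field_simp at e ⊢
      linarith
    exact (sq_eq_sq₀ (by positivity) (by positivity)).1 e'
  rw [nonConformality, mininorm, div_inv_eq_mul, eccentricity, sq, mul_div_assoc, ← h3]
  exact mul_le_mul h1 h2 (norm_nonneg _) (by positivity)

/-- The point `antiPart N / star (linPart N)` is the image of the center of the disk under `N`, and
`M` sends it to the corresponding point of `M * N`. Its modulus measures the eccentricity. -/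
lemma antiPart_mul_le_of_mapsIntoDisk {ρ : ℝ} {M N : Matrix (Fin 2) (Fin 2) ℝ}
    (hN : linPart N ≠ 0) (h : MapsIntoDisk ρ M (antiPart N / star (linPart N))) :
    ‖antiPart (M * N)‖ ≤ ρ * ‖linPart (M * N)‖ := by
  have hN' : star (linPart N) ≠ 0 := star_ne_zero.2 hN
  have e1 : antiPart (M * N) =
      (linPart M * (antiPart N / star (linPart N)) + antiPart M) * star (linPart N) := by
    rw [antiPart_mul]
    field_simp
  have e2 : star (linPart (M * N)) = (star (antiPart M) * (antiPart N / star (linPart N)) +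
      star (linPart M)) * star (linPart N) := by
    rw [linPart_mul, star_add, star_mul', star_mul', star_star]
    field_simp
    ring
  rw [← norm_star (linPart (M * N)), e1, e2, norm_mul, norm_mul, ← mul_assoc]
  exact mul_le_mul_of_nonneg_right h.le (norm_nonneg _)

/-- The state is the conjugated product read so far; it is good when it keeps the center of the disk
within radius `ρ`, and `DiskCovering` supplies two continuations. -/
lemma exists_bounded_branching {ι : Type*} [Finite ι] {M : ι → Matrix (Fin 2) (Fin 2) ℝ}
    (hM : ∀ i, 0 < (M i).det) (h : DiskCovering M) :
    ∃ (C : ℝ) (l : ℕ) (x : (ℕ → Bool) → ℕ → ι), 0 < l ∧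
      (∀ c m n, eccentricity (seqProd M (fun j => x c (m + j)) n) ≤ C) ∧
      (∀ c c' n, (∀ j < n, c j = c' j) → ∀ i < l * n, x c i = x c' i) ∧
      ∀ c c' n, (∀ i < l * n, x c i = x c' i) → ∀ j < n, c j = c' j := by
  obtain ⟨H, hH, ρ, hρ, hρ1, l, hcov⟩ := h
  have hl : 0 < l := by
    obtain ⟨p, q, ⟨j, hj, -⟩, -⟩ := hcov 0 (by simpa using hρ.le)
    omega
  have hHu : IsUnit H.det := hH.ne'.isUnit
  have hHi : 0 < H⁻¹.det := by
    rw [Matrix.det_nonsing_inv, Ring.inverse_eq_inv']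
    exact inv_pos.2 hH
  have hseq : ∀ x n, 0 < (seqProd M x n).det := det_seqProd_pos hM
  have hstepdet : ∀ p, 0 < (H⁻¹ * seqProd M p l * H).det := fun p => by
    rw [Matrix.det_mul, Matrix.det_mul]
    exact mul_pos (mul_pos hHi (hseq _ _)) hH
  obtain ⟨x, g, hg0, hg1, hgood, hx, hx'⟩ := exists_branching
    (step := fun G p => H⁻¹ * seqProd M p l * H * G)
    (Good := fun G : Matrix (Fin 2) (Fin 2) ℝ => 0 < G.det ∧ ‖antiPart G‖ ≤ ρ * ‖linPart G‖)
    (l := l) (g₀ := 1)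
    (fun G p q hpq => by simp only [seqProd_congr M hpq])
    (fun G hG => by
      have hlin : linPart G ≠ 0 := by
        intro h0
        have h1 := hG.1
        rw [det_eq_normSq_sub, h0, Complex.normSq_zero] at h1
        linarith [Complex.normSq_nonneg (antiPart G)]
      obtain ⟨p, q, hpq, hp, hq⟩ := hcov (antiPart G / star (linPart G)) (by
        rw [norm_div, norm_star, div_le_iff₀ (norm_pos_iff.2 hlin)]
        exact hG.2)
      exact ⟨p, q, hpq, ⟨by rw [Matrix.det_mul]; exact mul_pos (hstepdet p) hG.1,
        antiPart_mul_le_of_mapsIntoDisk hlin hp⟩, ⟨by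
        rw [Matrix.det_mul]; exact mul_pos (hstepdet q) hG.1,
        antiPart_mul_le_of_mapsIntoDisk hlin hq⟩⟩)
    ⟨by simp, by
      have : antiPart 1 = 0 := by apply Complex.ext <;> simp [antiPart]
      rw [this, norm_zero]
      positivity⟩
  have hprod : ∀ c j, seqProd M (x c) (l * j) = H * g c j * H⁻¹ := by
    intro c j
    induction j with
    | zero => rw [hg0, mul_one, Matrix.mul_nonsing_inv _ hHu]; rfl
    | succ j ih =>
      rw [mul_add, mul_one, seqProd_add, ih, hg1]
      simp only [mul_assoc]
      rw [Matrix.mul_nonsing_inv_cancel_left _ _ hHu]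
  obtain ⟨B, hB1, hB⟩ : ∃ B : ℝ, 1 ≤ B ∧ ∀ i, eccentricity (M i) ≤ B := by
    obtain ⟨B, hB⟩ := (Set.finite_range fun i => eccentricity (M i)).bddAbove
    exact ⟨max 1 B, le_max_left _ _, fun i => (hB ⟨i, rfl⟩).trans (le_max_right _ _)⟩
  have hone : eccentricity (1 : Matrix (Fin 2) (Fin 2) ℝ) ≤ 1 := by
    have h1 : antiPart 1 = 0 := by apply Complex.ext <;> simp [antiPart]
    have h2 : linPart 1 = 1 := by apply Complex.ext <;> simp [linPart]
    simp [eccentricity, h1, h2]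
  have hpow : ∀ y r, eccentricity (seqProd M y r) ≤ B ^ r := by
    intro y r
    induction r with
    | zero => simpa [seqProd] using hone
    | succ r ih =>
      rw [seqProd, pow_succ']
      exact (eccentricity_mul_le (hM _) (hseq _ _)).trans
        (mul_le_mul (hB _) ih (eccentricity_nonneg (hseq _ _)) (by linarith))
  set κ := eccentricity H * ((1 + ρ) / (1 - ρ)) * eccentricity H⁻¹ with hκ
  -- A prefix is a whole number of blocks, controlled by the state, followed by fewer than `l`
  -- letters, controlled by `B ^ l`.
  have hpre : ∀ c n, eccentricity (seqProd M (x c) n) ≤ B ^ l * κ := by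
    intro c n
    rw [← Nat.div_add_mod n l, seqProd_add]
    refine (eccentricity_mul_le (hseq _ _) (hseq _ _)).trans
      (mul_le_mul ((hpow _ _).trans (pow_le_pow_right₀ hB1 (Nat.mod_lt n hl).le)) ?_
        (eccentricity_nonneg (hseq _ _)) (by positivity))
    rw [hprod]
    have hg := hgood c (n / l)
    refine (eccentricity_mul_le (by rw [Matrix.det_mul]; exact mul_pos hH hg.1) hHi).trans ?_
    refine mul_le_mul_of_nonneg_right ?_ (eccentricity_nonneg hHi)
    refine (eccentricity_mul_le hH hg.1).trans ?_
    exact mul_le_mul_of_nonneg_left (eccentricity_le_of_antiPart_le hg.1 hρ1 hg.2)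
      (eccentricity_nonneg hH)
  refine ⟨B ^ l * κ * (B ^ l * κ), l, x, hl, fun c m n => ?_, hx, hx'⟩
  -- An inner product is a quotient of two prefixes, and inversion preserves eccentricity, so the
  -- bound gets squared.
  have hsplit : seqProd M (fun j => x c (m + j)) n =
      seqProd M (x c) (m + n) * (seqProd M (x c) m)⁻¹ := by
    rw [seqProd_add, Matrix.mul_nonsing_inv_cancel_right _ _ (hseq _ _).ne'.isUnit]
  have hinv : 0 < (seqProd M (x c) m)⁻¹.det := by
    rw [Matrix.det_nonsing_inv, Ring.inverse_eq_inv']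
    exact inv_pos.2 (hseq _ _)
  rw [hsplit]
  refine (eccentricity_mul_le (hseq _ _) hinv).trans ?_
  rw [eccentricity_inv (hseq _ _)]
  exact mul_le_mul (hpre _ _) (hpre _ _) (eccentricity_nonneg (hseq _ _))
    ((eccentricity_nonneg (hseq _ _)).trans (hpre c (m + n)))

/-! ### The compact invariant set and its entropy -/

section BoundedSet

variable {k : ℕ} {M : Fin k → Matrix (Fin 2) (Fin 2) ℝ}

/-- The two-sided words along which all products have eccentricity at most `C`. -/
def boundedWords (M : Fin k → Matrix (Fin 2) (Fin 2) ℝ) (C : ℝ) : Set (ℤ → Fin k) :=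
  {ω | ∀ (m : ℤ) (n : ℕ), eccentricity (seqProd M (fun j => ω (m + j)) n) ≤ C}

/-- The condition involves finitely many letters of a finite alphabet. -/
lemma isClosed_setOf_eccentricity_le (M : Fin k → Matrix (Fin 2) (Fin 2) ℝ) (C : ℝ) (m : ℤ)
    (n : ℕ) : IsClosed {ω : ℤ → Fin k | eccentricity (seqProd M (fun j => ω (m + j)) n) ≤ C} := by
  have h : Continuous fun ω : ℤ → Fin k => fun j : Fin n => ω (m + (j : ℕ)) := by fun_prop
  have e : {ω : ℤ → Fin k | eccentricity (seqProd M (fun j => ω (m + j)) n) ≤ C} =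
      (fun ω : ℤ → Fin k => fun j : Fin n => ω (m + (j : ℕ))) ⁻¹'
        ((fun ω : ℤ → Fin k => fun j : Fin n => ω (m + (j : ℕ))) ''
          {ω : ℤ → Fin k | eccentricity (seqProd M (fun j => ω (m + j)) n) ≤ C}) := by
    refine Set.Subset.antisymm (Set.subset_preimage_image _ _) ?_
    rintro ω ⟨ω', h', he⟩
    have : seqProd M (fun j => ω (m + j)) n = seqProd M (fun j => ω' (m + j)) n :=
      seqProd_congr M fun j hj => (congrFun he ⟨j, hj⟩).symm
    change eccentricity _ ≤ C
    rw [this]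
    exact h'
  rw [e]
  exact (isClosed_discrete _).preimage h

lemma isCompact_boundedWords (C : ℝ) : IsCompact (boundedWords M C) := by
  apply IsClosed.isCompact
  simp only [boundedWords, Set.ofPred_forall]
  exact isClosed_iInter fun m => isClosed_iInter fun n => isClosed_setOf_eccentricity_le M C m n

lemma image_boundedWords (C : ℝ) : fullShift k '' boundedWords M C = boundedWords M C := by
  have key : ∀ ω, fullShift k ω ∈ boundedWords M C ↔ ω ∈ boundedWords M C := by
    intro ω
    have e : ∀ (m : ℤ) n, seqProd M (fun j => fullShift k ω (m + j)) n =
        seqProd M (fun j => ω (m + 1 + j)) n := by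
      intro m n
      refine seqProd_congr M fun j _ => ?_
      change ω (m + j + 1) = _
      rw [add_right_comm]
    constructor
    · intro h m n
      have := h (m - 1) n
      rwa [e, sub_add_cancel] at this
    · intro h m n
      rw [e]
      exact h _ _
  ext ω
  constructor
  · rintro ⟨ω', h, rfl⟩
    exact (key ω').2 h
  · intro h
    exact ⟨(fullShift k).symm ω, (key _).1 (by simpa using h), by simp⟩

/-- The tree gives one-sided words. Delaying the choices by `N` blocks and shifting gives separated
families with bounded products from time `-N` on, and compactness of the space of families lets `N`
tend to infinity. -/
lemma exists_separated_boundedWords {C : ℝ} {l : ℕ} (hl : 0 < l) {x : (ℕ → Bool) → ℕ → Fin k}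
    (hC : ∀ c m n, eccentricity (seqProd M (fun j => x c (m + j)) n) ≤ C)
    (hx : ∀ c c' n, (∀ j < n, c j = c' j) → ∀ i < l * n, x c i = x c' i)
    (hx' : ∀ c c' n, (∀ i < l * n, x c i = x c' i) → ∀ j < n, c j = c' j) (n : ℕ) :
    ∃ f : (Fin n → Bool) → ℤ → Fin k, (∀ c, f c ∈ boundedWords M C) ∧
      ∀ c c', c ≠ c' → ∃ i : Fin (l * n), f c (i : ℕ) ≠ f c' (i : ℕ) := by
  let S : ℕ → Set ((Fin n → Bool) → ℤ → Fin k) := fun N =>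
    {f | ∀ c, ∀ m : ℤ, -N ≤ m → ∀ r : ℕ, eccentricity (seqProd M (fun j => f c (m + j)) r) ≤ C}
  let R : Set ((Fin n → Bool) → ℤ → Fin k) :=
    {f | ∀ c c', c ≠ c' → ∃ i : Fin (l * n), f c (i : ℕ) ≠ f c' (i : ℕ)}
  let Y : ℕ → Set ((Fin n → Bool) → ℤ → Fin k) := fun N => S N ∩ R
  have hS : ∀ N, IsClosed (S N) := by
    intro N
    simp only [S, Set.ofPred_forall]
    refine isClosed_iInter fun c => isClosed_iInter fun m => isClosed_iInter fun _ =>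
      isClosed_iInter fun r => ?_
    have : Continuous fun f : (Fin n → Bool) → ℤ → Fin k => f c := continuous_apply c
    exact (isClosed_setOf_eccentricity_le M C m r).preimage this
  have hR : IsClosed R := by
    simp only [R, Set.ofPred_forall, Set.ofPred_exists]
    refine isClosed_iInter fun c => isClosed_iInter fun c' => isClosed_iInter fun _ =>
      isClosed_iUnion_of_finite fun i => ?_
    have : Continuous fun f : (Fin n → Bool) → ℤ → Fin k =>
        (f c ((i : ℕ) : ℤ), f c' ((i : ℕ) : ℤ)) := by fun_prop
    exact (isClosed_discrete {p : Fin k × Fin k | p.1 ≠ p.2}).preimage this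
  have hclosed : ∀ N, IsClosed (Y N) := fun N => (hS N).inter hR
  have hne : (⋂ N, Y N).Nonempty := by
    refine IsCompact.nonempty_iInter_of_sequence_nonempty_isCompact_isClosed Y ?_ ?_
      (hclosed 0).isCompact hclosed
    · rintro N f ⟨h1, h2⟩
      exact ⟨fun c m hm => h1 c m (by push_cast; linarith), h2⟩
    · intro N
      -- The first `N` choices are constant and the next `n` are `c`. After the shift by `l * N`
      -- letters, the blocks of `c` occupy the positions from `0` to `l * n - 1`; positions before
      -- `-l * N` are irrelevant because `N ≤ l * N`.
      let e : (Fin n → Bool) → ℕ → Bool := fun c j =>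
        if h : N ≤ j ∧ j - N < n then c ⟨j - N, h.2⟩ else false
      refine ⟨fun c i => x (e c) (i + l * N).toNat, fun c m hm r => ?_, fun c c' hcc => ?_⟩
      · have : seqProd M (fun j => x (e c) (m + j + l * N).toNat) r =
            seqProd M (fun j => x (e c) ((m + l * N).toNat + j)) r := by
          refine seqProd_congr M fun j _ => ?_
          congr 1
          have : (0 : ℤ) ≤ m + l * N := by nlinarith
          omega
        rw [this]
        exact hC _ _ _
      · by_contra! h
        apply hcc
        have hall : ∀ i < l * (N + n), x (e c) i = x (e c') i := by
          intro i hi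
          rcases lt_or_ge i (l * N) with h1 | h1
          · refine hx _ _ N (fun j hj => ?_) i h1
            simp only [e]
            rw [dif_neg (by omega), dif_neg (by omega)]
          · rw [mul_add] at hi
            have := h ⟨i - l * N, by omega⟩
            simp only at this
            rwa [show (((i - l * N : ℕ) : ℤ) + l * N).toNat = i by
              rw [Nat.cast_sub h1]; push_cast; simp] at this
        ext j
        have := hx' _ _ (N + n) hall (N + j) (by omega)
        simp only [e] at this
        rw [dif_pos ⟨by omega, by omega⟩, dif_pos ⟨by omega, by omega⟩] at this
        simpa using congrArg (· = true) this
  obtain ⟨f, hf⟩ := hne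
  rw [Set.mem_iInter] at hf
  exact ⟨f, fun c m r => (hf m.natAbs).1 c m (by omega) r, (hf 0).2⟩

open Dynamics in
-- The families provide `2 ^ n` separated orbits over time `l * n`, so the entropy times `l` is at
-- least `log 2`.
lemma shiftEntropy_pos_of_separated {K : Set (ℤ → Fin k)} {l : ℕ} (hl : 0 < l)
    (h : ∀ n, ∃ f : (Fin n → Bool) → ℤ → Fin k, (∀ c, f c ∈ K) ∧
      ∀ c c', c ≠ c' → ∃ i : Fin (l * n), f c (i : ℕ) ≠ f c' (i : ℕ)) :
    0 < shiftEntropy k K := by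
  let _ : UniformSpace (Fin k) := ⊥
  let U : SetRel (ℤ → Fin k) (ℤ → Fin k) := {p | p.1 0 = p.2 0}
  have hU : U ∈ uniformity (ℤ → Fin k) := by
    rw [Pi.uniformity]
    refine Filter.mem_iInf_of_mem 0 (Filter.mem_comap.2 ⟨{p | p.1 = p.2}, ?_, fun p hp => hp⟩)
    exact Filter.mem_principal_self _
  have hcard : ∀ n, ((2 ^ n : ℕ) : ℕ∞) ≤ netMaxcard (fullShift k) K U (l * n) := by
    intro n
    obtain ⟨f, hf, hsep⟩ := h n
    classical
    have hinj : Function.Injective f := by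
      intro c c' hcc
      by_contra hne
      obtain ⟨i, hi⟩ := hsep c c' hne
      exact hi (by rw [hcc])
    have hnet : IsDynNetIn (fullShift k) K U (l * n) (Finset.univ.image f : Finset _) := by
      constructor
      · intro ω hω
        simp only [Finset.coe_image, Finset.coe_univ, Set.image_univ] at hω
        obtain ⟨c, rfl⟩ := hω
        exact hf c
      · intro ω hω ω' hω' hne
        simp only [Finset.coe_image, Finset.coe_univ, Set.image_univ] at hω hω'
        obtain ⟨c, rfl⟩ := hω
        obtain ⟨c', rfl⟩ := hω'
        obtain ⟨i, hi⟩ := hsep c c' fun hcc => hne (by rw [hcc])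
        rw [Function.onFun, Set.disjoint_left]
        intro y hy hy'
        -- Dynamical nets require disjoint balls, not just distant centers; agreement at a
        -- coordinate is transitive, so a common point would identify the centers there.
        have key : ∀ ω, y ∈ UniformSpace.ball ω (dynEntourage (fullShift k) U (l * n)) →
            ω (i : ℕ) = y (i : ℕ) := by
          intro ω hω
          have h1 : (ω, y) ∈ dynEntourage (fullShift k) U (l * n) := hω
          rw [mem_dynEntourage] at h1
          have h2 : (fullShift k)^[i] ω 0 = (fullShift k)^[i] y 0 := h1 i i.2
          rwa [fullShift_iterate_apply, fullShift_iterate_apply, zero_add] at h2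
        exact hi ((key _ hy).trans (key _ hy').symm)
    have := hnet.card_le_netMaxcard
    rw [Finset.card_image_of_injective _ hinj] at this
    simpa using this
  have hmono : Monotone fun n => ((netMaxcard (fullShift k) K U n : ℕ∞) : ENNReal) := by
    intro n m hnm
    have := netMaxcard_monotone_time (fullShift k) K U hnm
    simp only at this ⊢
    exact_mod_cast this
  have h1 : ENNReal.log 2 ≤ l * netEntropyEntourage (fullShift k) K U := by
    rw [netEntropyEntourage, ← hmono.expGrowthSup_comp_mul hl.ne', ← ExpGrowth.expGrowthSup_pow]
    apply ExpGrowth.expGrowthSup_monotone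
    intro n
    have := hcard n
    simp only
    exact_mod_cast this
  have h2 : 0 < netEntropyEntourage (fullShift k) K U := by
    by_contra! hle
    have h3 : (l : EReal) * netEntropyEntourage (fullShift k) K U ≤ 0 :=
      mul_nonpos_of_nonneg_of_nonpos (by positivity) hle
    have h4 : 0 < ENNReal.log 2 := by
      rw [← ENNReal.log_one]
      exact ENNReal.log_lt_log (by norm_num)
    exact absurd (h1.trans h3) (not_le.2 h4)
  exact h2.trans_le (netEntropyEntourage_le_coverEntropy _ _ hU)

end BoundedSet

lemma exists_boundedWords {k : ℕ} {A : Fin k → GL(2, ℝ)⁺}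
    (h : DiskCovering fun i => ((A i : GL (Fin 2) ℝ) : Matrix (Fin 2) (Fin 2) ℝ)) :
    ∃ K : Set (ℤ → Fin k), IsCompact K ∧ fullShift k '' K = K ∧ 0 < shiftEntropy k K ∧
      ∃ C : ℝ, ∀ ω ∈ K, ∀ n : ℤ,
        nonConformality (cocycleZProd (fullShift k) (oneStep A) n ω) ≤ C := by
  set M : Fin k → Matrix (Fin 2) (Fin 2) ℝ := fun i => ((A i : GL (Fin 2) ℝ) : Matrix _ _ ℝ) with hM
  have hdet : ∀ i, 0 < (M i).det := fun i => (A i).2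
  obtain ⟨C, l, x, hl, hC, hx, hx'⟩ := exists_bounded_branching hdet h
  refine ⟨boundedWords M C, isCompact_boundedWords C, image_boundedWords C,
    shiftEntropy_pos_of_separated hl (exists_separated_boundedWords hl hC hx hx'), C,
    fun ω hω n => ?_⟩
  have hprod : ∀ (n : ℕ) (ω : ℤ → Fin k),
      ((cocycleProd (fullShift k) (oneStep A) n ω : GL (Fin 2) ℝ) : Matrix (Fin 2) (Fin 2) ℝ) =
        seqProd M (fun j => ω j) n := fun n ω => by
    rw [cocycleProd_eq_seqProd]
    exact map_seqProd (Units.coeHom (Matrix (Fin 2) (Fin 2) ℝ)) _ _ _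
  rcases n with n | n
  · change nonConformality (cocycleProd (fullShift k) (oneStep A) n ω) ≤ C
    refine (nonConformality_le ?_).trans ?_
    · rw [hprod]; exact det_seqProd_pos hdet _ _
    · rw [hprod]
      simpa using hω 0 n
  · change nonConformality (cocycleProd (fullShift k) (oneStep A) (n + 1)
      ((fullShift k).symm^[n + 1] ω))⁻¹ ≤ C
    have hd : 0 < (seqProd M (fun j => (fullShift k).symm^[n + 1] ω j) (n + 1)).det :=
      det_seqProd_pos hdet _ _
    have hinv := Matrix.coe_units_inv (cocycleProd (fullShift k) (oneStep A) (n + 1)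
      ((fullShift k).symm^[n + 1] ω))
    rw [hprod] at hinv
    refine (nonConformality_le ?_).trans ?_
    · rw [hinv, Matrix.det_nonsing_inv, Ring.inverse_eq_inv']
      exact inv_pos.2 hd
    -- Negative times reduce to the inverse of a product along a backward shift, which stays in the
    -- set.
    · rw [hinv, eccentricity_inv hd]
      have hmem : ∀ j : ℕ, (fullShift k).symm^[j] ω ∈ boundedWords M C := by
        intro j
        induction j with
        | zero => exact hω
        | succ j ih =>
          rw [Function.iterate_succ_apply']
          rw [← image_boundedWords] at ih
          obtain ⟨ω', h', he⟩ := ih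
          rw [← he]
          simpa using h'
      simpa using hmem (n + 1) 0 (n + 1)

/-! ### Transfer to the group and conclusion -/

/-- The generators as a tuple of matrices. -/
def toMatrices {k : ℕ} (A : Fin k → GL(2, ℝ)⁺) (i : Fin k) : Matrix (Fin 2) (Fin 2) ℝ :=
  ((A i : GL (Fin 2) ℝ) : Matrix (Fin 2) (Fin 2) ℝ)

lemma continuous_toMatrices {k : ℕ} : Continuous (toMatrices (k := k)) :=
  continuous_pi fun i => Units.continuous_val.comp (continuous_subtype_val.comp (continuous_apply i))

/-- The topology of the units also sees the inverse, but on invertible matrices the inverse is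
continuous in the entries by the adjugate formula. -/
lemma isInducing_coe_GL : Topology.IsInducing (Units.val : GL (Fin 2) ℝ → Matrix (Fin 2) (Fin 2) ℝ) := by
  refine (Units.isEmbedding_val_mk' (f := fun M : Matrix (Fin 2) (Fin 2) ℝ => M.det⁻¹ • M.adjugate)
    ?_ fun u => ?_).isInducing
  · refine ContinuousOn.smul (ContinuousOn.inv₀ (continuous_id.matrix_det).continuousOn ?_)
      (continuous_id.matrix_adjugate).continuousOn
    intro M hM
    exact ((Matrix.isUnit_iff_isUnit_det M).1 hM).ne_zero
  · rw [Matrix.coe_units_inv, Matrix.inv_def, Ring.inverse_eq_inv']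

lemma exists_nhds_toMatrices {k : ℕ} {A : Fin k → GL(2, ℝ)⁺} {U : Set (Fin k → GL(2, ℝ)⁺)}
    (hU : U ∈ nhds A) : ∃ W ∈ nhds (toMatrices A), ∀ B ∈ W, (∀ i, 0 < (B i).det) →
      ∃ A' ∈ U, toMatrices A' = B := by
  have hind : Topology.IsInducing (toMatrices (k := k)) := by
    have h1 : Topology.IsInducing fun g : GL(2, ℝ)⁺ => ((g : GL (Fin 2) ℝ) : Matrix (Fin 2) (Fin 2) ℝ) :=
      isInducing_coe_GL.comp Topology.IsInducing.subtypeVal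
    exact Topology.IsInducing.piMap fun _ => h1
  rw [hind.nhds_eq_comap, Filter.mem_comap] at hU
  obtain ⟨W, hW, hWU⟩ := hU
  refine ⟨W, hW, fun B hB hdet => ?_⟩
  refine ⟨fun i => ⟨Matrix.GeneralLinearGroup.mkOfDetNeZero (B i) (hdet i).ne', hdet i⟩,
    hWU ?_, rfl⟩
  exact hB

theorem mainTheorem5 (k : ℕ) (hk : 2 ≤ k) :
    ∃ V : Set (Fin k → GL(2, ℝ)⁺), IsOpen V ∧ Dense V ∧
      ∀ A ∈ V,
        IsDominated (fullShift k) (oneStep A) ∨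
        ∃ K : Set (ℤ → Fin k), IsCompact K ∧ fullShift k '' K = K ∧
          0 < shiftEntropy k K ∧
          ∃ C : ℝ, ∀ ω ∈ K, ∀ n : ℤ,
            nonConformality (cocycleZProd (fullShift k) (oneStep A) n ω) ≤ C := by
  let E : Set (Fin k → GL(2, ℝ)⁺) := {A | DiskCovering (toMatrices A)}
  have hE : IsOpen E := (isOpen_diskCovering (Fin k)).preimage continuous_toMatrices
  -- Taking the interior avoids having to prove that domination is an open condition.
  refine ⟨interior {A | IsDominated (fullShift k) (oneStep A)} ∪ E,
    isOpen_interior.union hE, ?_, ?_⟩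
  · rw [dense_iff_inter_open]
    intro U hU hUne
    by_cases hdom : U ⊆ {A | IsDominated (fullShift k) (oneStep A)}
    · obtain ⟨A, hA⟩ := hUne
      exact ⟨A, hA, Or.inl (interior_maximal hdom hU hA)⟩
    obtain ⟨A, hAU, hA⟩ := Set.not_subset.1 hdom
    obtain ⟨W, hW, hWU⟩ := exists_nhds_toMatrices (hU.mem_nhds hAU)
    have hrot : Continuous fun θ => fun i => rotMat θ * toMatrices A i := by
      have : Continuous rotMat := by
        refine continuous_matrix fun i j => ?_
        fin_cases i <;> fin_cases j <;> simp [rotMat] <;> fun_prop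
      exact continuous_pi fun i => this.mul continuous_const
    have hrot0 : (fun i => rotMat 0 * toMatrices A i) = toMatrices A := by
      have : rotMat 0 = 1 := by
        ext i j
        fin_cases i <;> fin_cases j <;> simp [rotMat]
      simp [this]
    obtain ⟨ε, hε, hball⟩ := Metric.mem_nhds_iff.1 (hrot.continuousAt.preimage_mem_nhds
      (t := interior W) (x := 0) (by
        rw [hrot0]
        exact interior_mem_nhds.2 hW))
    -- The angle is halved so that the closed interval lies in the open ball of radius `ε`.
    have hex : ∃ x n, ∃ θ ∈ Set.Icc (-(ε / 2)) (ε / 2),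
        (seqProd (fun i => rotMat θ * toMatrices A i) x n).trace ^ 2 <
          4 * (seqProd (fun i => rotMat θ * toMatrices A i) x n).det := by
      by_contra! hno
      exact hA (isDominated_of_no_elliptic A (by omega) (half_pos hε) hno)
    obtain ⟨x, n, θ, hθ, hell⟩ := hex
    have hmem : (fun i => rotMat θ * toMatrices A i) ∈ interior W := hball (by
      rw [Metric.mem_ball, Real.dist_eq, sub_zero, abs_lt]
      constructor <;> linarith [hθ.1, hθ.2])
    -- A letter `v` other than the first letter of the elliptic word is needed for the probe; this
    -- is where `2 ≤ k` enters.
    have : Nontrivial (Fin k) := Fin.nontrivial_iff_two_le.2 hk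
    obtain ⟨v, hv⟩ := exists_ne (x 0)
    obtain ⟨B, hBW, hBdet, hBell, hBirr, hBcomm⟩ := exists_generic_near
      (fun i => rotMat θ * toMatrices A i) (fun i => by
        rw [Matrix.det_mul, det_rotMat, one_mul]
        exact (A i).2) hv.symm hell countable_finiteOrderValues (isOpen_interior.mem_nhds hmem)
    obtain ⟨A', hA'U, hA'⟩ := hWU B (interior_subset hBW) hBdet
    refine ⟨A', hA'U, Or.inr ?_⟩
    change DiskCovering (toMatrices A')
    rw [hA']
    exact diskCovering_of_elliptic hBdet hBell hBirr hBcomm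
  · intro A hA
    rcases hA with hA | hA
    · left
      have hsub : interior {A | IsDominated (fullShift k) (oneStep A)} ⊆
          {A | IsDominated (fullShift k) (oneStep A)} := interior_subset
      exact hsub hA
    · exact Or.inr (exists_boundedWords hA)
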